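/- **System.** There are $n\ge 1$ nodes, of which all but at most $f:=\lfloor (n-1)/3\rfloor$ belong to the set $C$ of correct nodes; the others are Byzantine. Let $\vartheta>1$, $0\le U\le d$, $F>0$, $\nu>0$. Each $v\in C$ has a hardware clock $H_v:\mathbb R_{\ge 0}\to\mathbb R_{\ge0}$ with $H_v(0)\in[0,F)$, $t'-t\le H_v(t')-H_v(t)\le\vartheta(t'-t)$ for $t<t'$, and derivative $h_v$ with values in $[1,\vartheta]$ that is $\nu$-Lipschitz. A pulse broadcast by $w\in C$ at time $s$ arrives at each $v\in C$ at a time in $[s+d-U,s+d]$; faulty nodes may send arbitrary pulses, separately to each node. Put $\bar\vartheta:=\vartheta^3$. **Algorithm** (waiting times $\tau_1,\dots,\tau_4$, nominal round length $T$, pull-back $\varepsilon$). Node $v\in C$ starts at the time $t_v(0)$ with $H_v(t_v(0))=F$ and sets $\mu_v(0)=\mu_v(1)=\vartheta$. In round $r\ge1$ it broadcasts a first pulse at time $p_v(r)$ with $H_v(p_v(r))=H_v(t_v(r-1))+\tau_1/\mu_v(r-1)$, stops its first listening phase, begun at $t_v(r-1)$, at local time $H_v(p_v(r))+\tau_2/\mu_v(r)$,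 broadcasts a second pulse at local time $H_v(p_v(r))+(\tau_2+\tau_3)/\mu_v(r)$, and stops its second listening phase, begun at the end of the first, at local time $H_v(p_v(r))+(\tau_2+\tau_3+\tau_4)/\mu_v(r)$. Let $t_{wv}$, $t'_{wv}$ be the times of the first pulses received from $w$ in the first and second listening phase. For a multiset $S$ of $n$ values let $\mathrm{mid}(S)$ be the mean of its $(f+1)$-th and $(n-f)$-th smallest elements. Node $v$ computes $$\Delta_v(r)=\mathrm{mid}_w\Big(\tfrac{2(H_v(t_{wv})-H_v(t_{vv}))}{\vartheta+1}\Big),\qquad \xi_v(r)=\mathrm{mid}_w\Big(1-\tfrac{\mu_v(r)(H_v(t'_{wv})-H_v(t_{wv}))}{\tau_2+\tau_3}\Big)$$ (entries with a missing pulse being infinite), $\hat\mu_v(r+1)=\mu_v(r)+2\xi_v(r)/(\vartheta+1)$, and lets $\mu_v(r+1)$ be $\hat\mu_v(r+1)+\varepsilon$ if $\hat\mu_v(r+1)\le\vartheta$ and $\hat\mu_v(r+1)-\varepsilon$ otherwise, restricted to the range $[1,\vartheta^2]$. It starts the next round at the time $t_v(r)$ with $H_v(t_v(r))=H_v(p_v(r))+(T+\Delta_v(r)-\tau_1)/\mu_v(r)$.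 **Constraints.** With $\bar\beta:=\frac{2\bar\vartheta^2+5\bar\vartheta-5}{2(\bar\vartheta+1)}$ and $e(1):=\max\big\{F+(1-\tfrac1{\bar\vartheta})\tau_1,\ \tfrac{(1-1/\bar\vartheta)T+(3\bar\vartheta-1)U}{1-\bar\beta}\big\}$, the parameters satisfy $$\tau_1\ge\bar\vartheta e(1),\quad \tau_2\ge\bar\vartheta(e(1)+d),\quad \tau_3\ge\bar\vartheta\big(e(1)+(1-\tfrac1{\bar\vartheta})(\tau_1+\tau_2)\big),\quad \tau_4\ge\bar\vartheta\big(e(1)+d+(1-\tfrac1{\bar\vartheta})(\tau_2+\tau_3)\big),$$ $$T\ge\tau_1+\tau_2+\tau_3+\tau_4+\bar\vartheta(e(1)+U),$$ $$\varepsilon\ge2\Big((\vartheta-1)(\vartheta^3-1)+2\vartheta^3\big(1-\tfrac1{\vartheta^3}\big)^2+\tfrac{2\vartheta^3U}{\tau_2+\tau_3}+2(\vartheta^3+1)\nu T\Big).$$ **Theorem 3.** Let $\bar\alpha:=\bar\beta+(4\bar\vartheta+3)(\bar\vartheta-1)<1$ (which is the case for $\vartheta\le1.01$). Then $\alpha:=\frac{4\bar\vartheta^2+5\bar\vartheta-7}{2(\bar\vartheta+1)}<1$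 and $\beta:=\frac{2\vartheta-1}2<1$, and: 1. If the constraints hold, every execution satisfies the following. Let $\|\vec\rho(r)\|$ be the difference between the maximum and the minimum of the rates $\mu_v(r)h_v(t)$ over $v\in C$ and $t\in[p_v(r),p_v(r+1)]$. The frequency error in the limit is $$\limsup_{r\to\infty}\|\vec\rho(r)\|\le\frac{3\vartheta\varepsilon+2\nu(T+\tau_2)}{1-\beta}+\nu(T+\tau_2)\in O(\varepsilon),$$ with an absolute constant in the $O$. The steady state (phase) error is $$E:=\limsup_{r\to\infty}\Big(\max_{v\in C}p_v(r)-\min_{v\in C}p_v(r)\Big)\le\frac{(4\bar\vartheta-2)U+\nu(T+\tau_2)T}{1-\alpha}+\frac{(3\vartheta\varepsilon+2\nu(T+\tau_2))T}{(1-\alpha)(1-\beta)}.$$ 2. Long rounds are possible with skew $O(U)$: there are absolute constants $c$ and $K$ such that for every $T\ge K(F+d+U)$ with $\max\{(\bar\vartheta-1)^2T,\nu T^2\}\le U$ there are $\tau_1,\dots,\tau_4,\varepsilon$ which satisfy the constraints together with $T$, and for which every execution has $E\le cU$. -/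

import Mathlib

noncomputable section

namespace ClockSync

open Set Filter

/-- The parameters of the system: `ϑ` is the largest hardware clock rate (the smallest being `1`),
`d` the maximum message delay, `U` the delay uncertainty, `F` the initial local time offset and `ν`
the Lipschitz constant of the hardware clock rates. -/
structure Model where
  ϑ : ℝ
  d : ℝ
  U : ℝ
  F : ℝ
  ν : ℝ

/-- Standing assumptions on the system parameters. -/
structure Model.Valid (M : Model) : Prop where
  one_lt : 1 < M.ϑ
  U_nonneg : 0 ≤ M.U
  U_le : M.U ≤ M.d
  F_pos : 0 < M.F
  ν_pos : 0 < M.ν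

/-- The parameters of the algorithm: waiting times `τ₁, …, τ₄`, nominal round length `T` and
pull-back `ε`. -/
structure Tuning where
  τ₁ : ℝ
  τ₂ : ℝ
  τ₃ : ℝ
  τ₄ : ℝ
  T : ℝ
  ε : ℝ

/-- `ϑ̄ = ϑ³`. -/
def Model.vbar (M : Model) : ℝ := M.ϑ ^ 3

/-- `β̄ = (2ϑ̄² + 5ϑ̄ - 5) / (2(ϑ̄ + 1))`. -/
def Model.betaBar (M : Model) : ℝ := (2 * M.vbar ^ 2 + 5 * M.vbar - 5) / (2 * (M.vbar + 1))

/-- `ᾱ = β̄ + (4ϑ̄ + 3)(ϑ̄ - 1)`. -/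
def Model.alphaBar (M : Model) : ℝ := M.betaBar + (4 * M.vbar + 3) * (M.vbar - 1)

/-- `α = (4ϑ̄² + 5ϑ̄ - 7) / (2(ϑ̄ + 1))`. -/
def Model.alpha (M : Model) : ℝ := (4 * M.vbar ^ 2 + 5 * M.vbar - 7) / (2 * (M.vbar + 1))

/-- `β = (2ϑ - 1) / 2`. -/
def Model.beta (M : Model) : ℝ := (2 * M.ϑ - 1) / 2

/-- `e(1)`, the bound on the skew of the first pulses. -/
def e₁ (M : Model) (A : Tuning) : ℝ :=
  max (M.F + (1 - 1 / M.vbar) * A.τ₁)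
    (((1 - 1 / M.vbar) * A.T + (3 * M.vbar - 1) * M.U) / (1 - M.betaBar))

/-- The constraints on the parameters of the algorithm. -/
structure Constraints (M : Model) (A : Tuning) : Prop where
  τ₁_ge : M.vbar * e₁ M A ≤ A.τ₁
  τ₂_ge : M.vbar * (e₁ M A + M.d) ≤ A.τ₂
  τ₃_ge : M.vbar * (e₁ M A + (1 - 1 / M.vbar) * (A.τ₁ + A.τ₂)) ≤ A.τ₃
  /- Between the first and the second pulse of a round, a node waits for `τ₂ + τ₃` (adjusted)
  local time. -/
  τ₄_ge : M.vbar * (e₁ M A + M.d + (1 - 1 / M.vbar) * (A.τ₂ + A.τ₃)) ≤ A.τ₄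
  T_ge : A.τ₁ + A.τ₂ + A.τ₃ + A.τ₄ + M.vbar * (e₁ M A + M.U) ≤ A.T
  ε_ge : 2 * ((M.ϑ - 1) * (M.ϑ ^ 3 - 1) + 2 * M.ϑ ^ 3 * (1 - 1 / M.ϑ ^ 3) ^ 2
      + 2 * M.ϑ ^ 3 * M.U / (A.τ₂ + A.τ₃) + 2 * (M.ϑ ^ 3 + 1) * M.ν * A.T) ≤ A.ε

/-- `H : ℝ≥0 → ℝ≥0` (as a function on `ℝ`, of which only the restriction to `[0, ∞)` matters) is a
hardware clock with derivative `h`: rates lie in `[1, ϑ]` and are `ν`-Lipschitz, and the initial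
value lies in `[0, F)`. -/
structure IsClock (M : Model) (H h : ℝ → ℝ) : Prop where
  init : H 0 ∈ Ico 0 M.F
  drift : ∀ s t, 0 ≤ s → s < t → t - s ≤ H t - H s ∧ H t - H s ≤ M.ϑ * (t - s)
  deriv : ∀ t, 0 ≤ t → HasDerivWithinAt H (h t) (Ici 0) t
  rate : ∀ t, 0 ≤ t → h t ∈ Icc 1 M.ϑ
  lipschitz : ∀ s t, 0 ≤ s → 0 ≤ t → |h t - h s| ≤ M.ν * |t - s|

/-- The `k`-th smallest element (`1 ≤ k ≤ n`) of the multiset `{S w | w}`. -/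
def kthSmallest {n : ℕ} (S : Fin n → EReal) (k : ℕ) : EReal :=
  if hk : k - 1 < n then S (Tuple.sort S ⟨k - 1, hk⟩) else ⊤

/-- The number of faults tolerated by `n` nodes. -/
def maxFaults (n : ℕ) : ℕ := (n - 1) / 3

/-- The outcome `(S^{f+1} + S^{n-f}) / 2` of an approximate agreement step on the values `S`.
The case that one of the two order statistics is infinite is not specified by the algorithm;
it is replaced by `0` then. -/
def agree {n : ℕ} (S : Fin n → EReal) : ℝ :=
  ((kthSmallest S (maxFaults n + 1)).toReal + (kthSmallest S (n - maxFaults n)).toReal) / 2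

open Classical in
/-- The first element of a set of times, if there is one. -/
def firstIn (s : Set ℝ) : Option ℝ := if hs : ∃ t, IsLeast s t then some hs.choose else none

/-- The measured phase offset `2(H(x) - H(y)) / (ϑ + 1)`, infinite if a pulse is missing. -/
def phaseValue (ϑ : ℝ) (H : ℝ → ℝ) : Option ℝ → Option ℝ → EReal
  | some x, some y => ((2 * (H x - H y) / (ϑ + 1) : ℝ) : EReal)
  | _, _ => ⊤

/-- The measured rate offset `1 - μ (H(x') - H(x)) / L`, infinite if a pulse is missing. -/
def rateValue (μ L : ℝ) (H : ℝ → ℝ) : Option ℝ → Option ℝ → EReal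
  | some x', some x => ((1 - μ * (H x' - H x) / L : ℝ) : EReal)
  | _, _ => ⊥

/-- Pull-back of a rate multiplier by `ε` towards the nominal one `ϑ`, staying in `[1, ϑ²]`. -/
def pullBack (ϑ ε m : ℝ) : ℝ :=
  if m ≤ ϑ then max 1 (min (ϑ ^ 2) (m + ε)) else max 1 (min (ϑ ^ 2) (m - ε))

/-- The data of a run of the system with `n` nodes. The fields are only meaningful for correct
nodes (with the exception of the sender of the pulses in `arr`). Rounds are numbered from `1`.
* `C`: correct nodes;
* `H v`, `h v`: hardware clock of `v` and its rate;
* `arr w v`: times at which `v` receives pulses from `w`;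
* `t v r`: time when `v` starts round `r + 1`;
* `p v r`, `q v r`: times when `v` broadcasts its first and second pulse in round `r`;
* `a v r`, `b v r`: times when `v` stops listening for first and second pulses in round `r`;
* `μ v r`: rate multiplier of `v`, in use between the first pulses of rounds `r` and `r + 1`. -/
structure Run (n : ℕ) where
  C : Finset (Fin n)
  H : Fin n → ℝ → ℝ
  h : Fin n → ℝ → ℝ
  arr : Fin n → Fin n → Set ℝ
  t : Fin n → ℕ → ℝ
  p : Fin n → ℕ → ℝ
  q : Fin n → ℕ → ℝ
  a : Fin n → ℕ → ℝ
  b : Fin n → ℕ → ℝ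
  μ : Fin n → ℕ → ℝ

namespace Run

variable {n : ℕ} (R : Run n)

/-- Arrival time at `v` of the first pulse from `w` while `v` listens for the first time in
round `r`. -/
def first (w v : Fin n) (r : ℕ) : Option ℝ :=
  firstIn (R.arr w v ∩ Icc (R.t v (r - 1)) (R.a v r))

/-- Arrival time at `v` of the first pulse from `w` while `v` listens for the second time in
round `r`. -/
def second (w v : Fin n) (r : ℕ) : Option ℝ :=
  firstIn (R.arr w v ∩ Ioc (R.a v r) (R.b v r))

/-- The phase correction `Δ_v(r)`. -/
def phaseCorr (ϑ : ℝ) (v : Fin n) (r : ℕ) : ℝ :=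
  agree fun w => phaseValue ϑ (R.H v) (R.first w v r) (R.first v v r)

/-- The rate correction `ξ_v(r)`; `L` is the nominal time between the two pulses of a round. -/
def rateCorr (L : ℝ) (v : Fin n) (r : ℕ) : ℝ :=
  agree fun w => rateValue (R.μ v r) L (R.H v) (R.second w v r) (R.first w v r)

/-- The skew `‖p(r)‖ = max_{v ∈ C} p_v(r) - min_{v ∈ C} p_v(r)`. -/
def skew (r : ℕ) : ℝ :=
  sSup ((fun v => R.p v r) '' (R.C : Set (Fin n))) - sInf ((fun v => R.p v r) '' (R.C : Set (Fin n)))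

/-- All adjusted clock rates `μ_v(r) h_v(s)` of correct nodes `v` at times
`s ∈ [p_v(r), p_v(r+1)]`. -/
def rates (r : ℕ) : Set ℝ :=
  {x | ∃ v ∈ R.C, ∃ s ∈ Icc (R.p v r) (R.p v (r + 1)), x = R.μ v r * R.h v s}

/-- The frequency error `‖ρ(r)‖`, the difference between the maximum and the minimum rate. -/
def rateSpread (r : ℕ) : ℝ := sSup (R.rates r) - sInf (R.rates r)

/-- The steady state error, `lim_{r' → ∞} sup_{r ≥ r'} ‖p(r)‖`. -/
def steadyState : EReal := limsup (fun r => (R.skew r : EReal)) atTop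

/-- The steady state frequency error, `lim_{r' → ∞} sup_{r ≥ r'} ‖ρ(r)‖`. -/
def steadyStateRate : EReal := limsup (fun r => (R.rateSpread r : EReal)) atTop

end Run

/-- The run `R` is an execution of the phase and frequency synchronization algorithm with
parameters `A` in the system `M`: at most `maxFaults n` nodes are faulty; the pulses of correct
nodes, and no other messages, arrive from them at correct nodes, each with a delay from
`[d - U, d]`, while nothing is assumed about messages from faulty nodes; and correct nodes follow
the algorithm. -/
structure IsExecution (M : Model) (A : Tuning) {n : ℕ} (R : Run n) : Prop where
  n_pos : 0 < n
  faults : (R.C)ᶜ.card ≤ maxFaults n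
  clock : ∀ v ∈ R.C, IsClock M (R.H v) (R.h v)
  delivery : ∀ w ∈ R.C, ∀ v ∈ R.C, ∃ x y : ℕ → ℝ,
    (∀ r, 1 ≤ r → x r ∈ Icc (R.p w r + M.d - M.U) (R.p w r + M.d)) ∧
    (∀ r, 1 ≤ r → y r ∈ Icc (R.q w r + M.d - M.U) (R.q w r + M.d)) ∧
    R.arr w v = {s | ∃ r, 1 ≤ r ∧ (s = x r ∨ s = y r)}
  nonneg : ∀ v ∈ R.C, ∀ r, 0 ≤ R.t v r ∧
    (1 ≤ r → 0 ≤ R.p v r ∧ 0 ≤ R.a v r ∧ 0 ≤ R.q v r ∧ 0 ≤ R.b v r)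
  /- initialization -/
  start : ∀ v ∈ R.C, R.H v (R.t v 0) = M.F
  μ_zero : ∀ v ∈ R.C, R.μ v 0 = M.ϑ
  μ_one : ∀ v ∈ R.C, R.μ v 1 = M.ϑ
  /- first pulse; the multiplier `μ v (r - 1)` is in use until it is sent -/
  pulse₁ : ∀ v ∈ R.C, ∀ r, 1 ≤ r →
    R.H v (R.p v r) = R.H v (R.t v (r - 1)) + A.τ₁ / R.μ v (r - 1)
  listen₁ : ∀ v ∈ R.C, ∀ r, 1 ≤ r →
    R.H v (R.a v r) = R.H v (R.t v (r - 1)) + A.τ₁ / R.μ v (r - 1) + A.τ₂ / R.μ v r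
  /- second pulse -/
  pulse₂ : ∀ v ∈ R.C, ∀ r, 1 ≤ r →
    R.H v (R.q v r) = R.H v (R.t v (r - 1)) + A.τ₁ / R.μ v (r - 1) + (A.τ₂ + A.τ₃) / R.μ v r
  listen₂ : ∀ v ∈ R.C, ∀ r, 1 ≤ r →
    R.H v (R.b v r)
      = R.H v (R.t v (r - 1)) + A.τ₁ / R.μ v (r - 1) + (A.τ₂ + A.τ₃ + A.τ₄) / R.μ v r
  /- frequency correction -/
  rate : ∀ v ∈ R.C, ∀ r, 1 ≤ r →
    R.μ v (r + 1)
      = pullBack M.ϑ A.ε (R.μ v r + 2 * R.rateCorr (A.τ₂ + A.τ₃) v r / (M.ϑ + 1))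
  /- phase correction: the next round starts such that the first pulses of rounds `r` and `r + 1`
  are separated by `T + Δ` adjusted local time (or immediately, should this time have passed) -/
  next : ∀ v ∈ R.C, ∀ r, 1 ≤ r →
    R.H v (R.t v r)
      = max (R.H v (R.t v (r - 1)) + A.τ₁ / R.μ v (r - 1)
            + (A.T + R.phaseCorr M.ϑ v r - A.τ₁) / R.μ v r)
          (R.H v (R.b v r))

end ClockSync

end

open ClockSync

noncomputable section

namespace ClockSync

open Set Filter

/-! Both corrections are approximate agreement steps. Let `m` be a median of the correct values. As
there are at most f < n/3 faults, at least f+1 correct values lie on either side of `m`, itself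
included. So the (f+1)-th smallest entry lies between the least correct value and `m`, and the
(n-f)-th between `m` and the greatest. Since `m` is the same for all nodes, nodes with measurement
error κ end up within half the old spread plus 2κ (`exists_agree_bounds`).

Phases: if the skew of a round is at most e(1), every correct pulse arrives in its listening window
(`windows`, `exists_arrivals`), so all measurements are genuine. With only the crude bounds 1 and ϑ̄
on the adjusted rates, agreement then keeps the skew below e(1) (`close_succ`). Induction gives
`regular`: no round ever fails.

Rates are compared in the middle of each round. The measured value is the difference of two rates up
to terms quadratic in the drift, U/(τ₂+τ₃) and νT, all covered by ε, so the spread contracts with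
factor β up to O(ε) (`midSpread_succ_le`). The danger is the restriction of multipliers to [1, ϑ²].
The pull-back keeps all rates within ϑε of [ϑ, ϑ²] (`midRate_band`). A node raised to 1 has rate at
most ϑ and one cut to ϑ² has rate at least ϑ², so neither increases the spread by more than O(ε).

The rate spread enters the skew recursion multiplied by T (`skew_succ_le`), and iterating the two
perturbed contractions gives the limits. For long rounds, waiting times proportional to T make every
term of Tε of order U. -/

/-! ### Order statistics and approximate agreement -/

theorem maxFaults_lt {n : ℕ} (hn : 0 < n) : 2 * maxFaults n + (maxFaults n + 1) ≤ n := by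
  unfold maxFaults; omega

/-- Otherwise all of `A` would sit at the first k-1 sorted positions, too few for its k elements. -/
theorem kthSmallest_le {n : ℕ} {S : Fin n → EReal} {k : ℕ} (hk : 1 ≤ k) (A : Finset (Fin n))
    (hA : k ≤ A.card) {u : EReal} (hu : ∀ w ∈ A, S w ≤ u) : kthSmallest S k ≤ u := by
  have hAn : A.card ≤ n := by simpa using A.card_le_univ
  have hkn : k - 1 < n := by omega
  unfold kthSmallest
  rw [dif_pos hkn]
  by_contra! h
  have hsub : A ⊆ (Finset.Iio (⟨k - 1, hkn⟩ : Fin n)).map (Tuple.sort S).toEmbedding := by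
    intro w hw
    rw [Finset.mem_map]
    refine ⟨(Tuple.sort S).symm w, ?_, by simp⟩
    rw [Finset.mem_Iio]
    by_contra! hle
    have := Tuple.monotone_sort S hle
    simp only [Function.comp_apply, Equiv.apply_symm_apply] at this
    exact absurd (hu w hw) (not_le.2 (lt_of_lt_of_le h this))
  have := Finset.card_le_card hsub
  simp at this
  omega

theorem le_kthSmallest {n : ℕ} {S : Fin n → EReal} {k : ℕ} (hk : 1 ≤ k) (hkn : k ≤ n)
    (B : Finset (Fin n)) (hB : n - k + 1 ≤ B.card) {l : EReal} (hl : ∀ w ∈ B, l ≤ S w) :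
    l ≤ kthSmallest S k := by
  have hkn' : k - 1 < n := by omega
  unfold kthSmallest
  rw [dif_pos hkn']
  by_contra! h
  have hsub : B ⊆ (Finset.Ioi (⟨k - 1, hkn'⟩ : Fin n)).map (Tuple.sort S).toEmbedding := by
    intro w hw
    rw [Finset.mem_map]
    refine ⟨(Tuple.sort S).symm w, ?_, by simp⟩
    rw [Finset.mem_Ioi]
    by_contra! hle
    have := Tuple.monotone_sort S hle
    simp only [Function.comp_apply, Equiv.apply_symm_apply] at this
    exact absurd (hl w hw) (not_le.2 (lt_of_le_of_lt this h))
  have := Finset.card_le_card hsub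
  simp at this
  omega

theorem exists_median {ι : Type*} (C : Finset ι) (y : ι → ℝ) {k : ℕ} (hk : 2 * k + 1 ≤ C.card) :
    ∃ m ∈ C, k + 1 ≤ (C.filter fun w => y w ≤ y m).card ∧
      k + 1 ≤ (C.filter fun w => y m ≤ y w).card := by
  classical
  have hC : C.Nonempty := Finset.card_pos.1 (by omega)
  -- The median is the least element having k+1 elements weakly below it; by minimality at most k
  -- elements lie strictly below.
  set D := C.filter fun m => k + 1 ≤ (C.filter fun w => y w ≤ y m).card with hD
  have hDne : D.Nonempty := by
    obtain ⟨m, hm, hmax⟩ := C.exists_max_image y hC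
    refine ⟨m, Finset.mem_filter.2 ⟨hm, ?_⟩⟩
    rw [Finset.filter_true_of_mem hmax]; omega
  obtain ⟨m, hm, hmin⟩ := D.exists_min_image y hDne
  rw [hD, Finset.mem_filter] at hm
  refine ⟨m, hm.1, hm.2, ?_⟩
  have hlt : (C.filter fun w => y w < y m).card ≤ k := by
    by_contra! hgt
    obtain ⟨m', hm', hmax⟩ := (C.filter fun w => y w < y m).exists_max_image y
      (Finset.card_pos.1 (by omega))
    rw [Finset.mem_filter] at hm'
    have : m' ∈ D := by
      refine Finset.mem_filter.2 ⟨hm'.1, le_trans hgt (Finset.card_le_card ?_)⟩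
      intro w hw
      exact Finset.mem_filter.2 ⟨(Finset.mem_filter.1 hw).1, hmax w hw⟩
    exact absurd (hmin m' this) (not_le.2 hm'.2)
  have hsum := Finset.card_filter_add_card_filter_not (s := C) (fun w => y w < y m)
  simp only [not_lt] at hsum
  omega

/-- Approximate agreement: there is a common point `m` such that every node which measures the
values `y w - c` with error at most `κ` ends up half-way between `m` and the range of `y`. -/
theorem exists_agree_bounds {n : ℕ} (hn : 0 < n) {C : Finset (Fin n)}
    (hC : Cᶜ.card ≤ maxFaults n) (y : Fin n → ℝ) {lo hi : ℝ}
    (hlo : ∀ w ∈ C, lo ≤ y w) (hhi : ∀ w ∈ C, y w ≤ hi) :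
    ∃ m ∈ Icc lo hi, ∀ (S : Fin n → EReal) (c κ : ℝ),
      (∀ w ∈ C, ∃ x : ℝ, S w = (x : EReal) ∧ |x - (y w - c)| ≤ κ) →
      (lo + m) / 2 - c - κ ≤ agree S ∧ agree S ≤ (m + hi) / 2 - c + κ := by
  have hf := maxFaults_lt hn
  set f := maxFaults n
  have hcard : n - f ≤ C.card := by
    rw [Finset.card_compl, Fintype.card_fin] at hC; omega
  obtain ⟨m, hm, hA, hB⟩ := exists_median C y (k := f) (by omega)
  refine ⟨y m, ⟨hlo m hm, hhi m hm⟩, fun S c κ hS => ?_⟩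
  have hS' : ∀ w ∈ C, ∀ l u : ℝ, l ≤ y w → y w ≤ u →
      ((l - c - κ : ℝ) : EReal) ≤ S w ∧ S w ≤ ((u - c + κ : ℝ) : EReal) := by
    intro w hw l u hl hu
    obtain ⟨x, hx, hxk⟩ := hS w hw
    rw [hx, EReal.coe_le_coe_iff, EReal.coe_le_coe_iff]
    rw [abs_le] at hxk
    constructor <;> linarith
  -- Each bound needs only enough correct witnesses: all n-f of them for the outer bounds, the f+1
  -- on one side of the median for the inner ones.
  have h1 : ((lo - c - κ : ℝ) : EReal) ≤ kthSmallest S (f + 1) :=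
    le_kthSmallest (by omega) (by omega) C (by omega)
      fun w hw => (hS' w hw lo hi (hlo w hw) (hhi w hw)).1
  have h2 : kthSmallest S (f + 1) ≤ ((y m - c + κ : ℝ) : EReal) :=
    kthSmallest_le (by omega) _ hA fun w hw =>
      have hw := Finset.mem_filter.1 hw
      (hS' w hw.1 lo _ (hlo w hw.1) hw.2).2
  have h3 : ((y m - c - κ : ℝ) : EReal) ≤ kthSmallest S (n - f) :=
    le_kthSmallest (by omega) (by omega) _ (by omega) fun w hw =>
      have hw := Finset.mem_filter.1 hw
      (hS' w hw.1 _ hi hw.2 (hhi w hw.1)).1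
  have h4 : kthSmallest S (n - f) ≤ ((hi - c + κ : ℝ) : EReal) :=
    kthSmallest_le (by omega) C hcard fun w hw => (hS' w hw lo hi (hlo w hw) (hhi w hw)).2
  have key : ∀ (z : EReal) (l u : ℝ), (l : EReal) ≤ z → z ≤ (u : EReal) →
      l ≤ z.toReal ∧ z.toReal ≤ u := by
    intro z l u hl hu
    induction z with
    | bot => simp at hl
    | top => simp at hu
    | coe z => simpa using ⟨EReal.coe_le_coe_iff.1 hl, EReal.coe_le_coe_iff.1 hu⟩
  have k1 := key _ _ _ h1 h2
  have k2 := key _ _ _ h3 h4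
  unfold agree
  constructor <;> linarith [k1.1, k1.2, k2.1, k2.2]

theorem firstIn_eq_some {s : Set ℝ} {t : ℝ} (h : IsLeast s t) : firstIn s = some t := by
  have hs : ∃ t, IsLeast s t := ⟨t, h⟩
  unfold firstIn
  rw [dif_pos hs, hs.choose_spec.unique h]

/-! ### Iteration of perturbed contractions -/

/-- Perturbed contractions. -/
theorem eventually_le_of_contraction {x y : ℕ → ℝ} {a Y : ℝ} {N : ℕ} (ha : 0 ≤ a) (ha1 : a < 1)
    (hx : ∀ r, N ≤ r → x (r + 1) ≤ a * x r + y r)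
    (hy : ∀ η > 0, ∀ᶠ r in atTop, y r ≤ Y + η) :
    ∀ η > 0, ∀ᶠ r in atTop, x r ≤ Y / (1 - a) + η := by
  intro η hη
  have h1a : 0 < 1 - a := by linarith
  obtain ⟨M, hM⟩ := eventually_atTop.1 (hy ((1 - a) * (η / 2)) (by positivity))
  set r₀ := max M N
  -- Fixed point of the affine recursion with input Y + (1-a)η/2. Half of η pays for the excess of
  -- the input, the other half for the transient.
  set z := Y / (1 - a) + η / 2 with hz
  have hzY : a * z + (Y + (1 - a) * (η / 2)) = z := by
    rw [hz]; field_simp; ring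
  have hk : ∀ k : ℕ, x (r₀ + k) ≤ a ^ k * |x r₀ - z| + z := by
    intro k
    induction k with
    | zero => simpa using (by linarith [le_abs_self (x r₀ - z)] : x r₀ ≤ |x r₀ - z| + z)
    | succ k ih =>
      have h1 := hx (r₀ + k) (le_trans (le_max_right _ _) (Nat.le_add_right _ _))
      have h2 := hM (r₀ + k) (le_trans (le_max_left _ _) (Nat.le_add_right _ _))
      calc x (r₀ + (k + 1)) ≤ a * x (r₀ + k) + y (r₀ + k) := h1
        _ ≤ a * (a ^ k * |x r₀ - z| + z) + (Y + (1 - a) * (η / 2)) := by gcongr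
        _ = a ^ (k + 1) * |x r₀ - z| + z := by rw [pow_succ]; linear_combination hzY
  have hlim : Tendsto (fun k : ℕ => a ^ k * |x r₀ - z|) atTop (nhds 0) := by
    simpa using (tendsto_pow_atTop_nhds_zero_of_lt_one ha ha1).mul_const |x r₀ - z|
  obtain ⟨k₀, hk₀⟩ := eventually_atTop.1 (hlim.eventually (gt_mem_nhds (half_pos hη)))
  filter_upwards [eventually_ge_atTop (r₀ + k₀)] with r hr
  obtain ⟨k, rfl⟩ := Nat.exists_eq_add_of_le (le_trans (Nat.le_add_right r₀ k₀) hr)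
  have := hk₀ k (by omega)
  linarith [hk k]

theorem limsup_coe_le {x : ℕ → ℝ} {Y : ℝ} (h : ∀ η > 0, ∀ᶠ r in atTop, x r ≤ Y + η) :
    limsup (fun r => (x r : EReal)) atTop ≤ (Y : EReal) := by
  refine EReal.le_of_forall_lt_iff_le.1 fun z hz => ?_
  rw [EReal.coe_lt_coe_iff] at hz
  refine limsup_le_of_le (by isBoundedDefault) ?_
  filter_upwards [h (z - Y) (by linarith)] with r hr
  exact EReal.coe_le_coe_iff.2 (by linarith)

theorem sSup_sub_sInf_le {s : Set ℝ} (hs : s.Nonempty) {B : ℝ}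
    (h : ∀ x ∈ s, ∀ y ∈ s, x - y ≤ B) : sSup s - sInf s ≤ B := by
  have : sSup s ≤ B + sInf s := csSup_le hs fun x hx => by
    have : x - B ≤ sInf s := le_csInf hs fun y hy => by linarith [h x hx y hy]
    linarith
  linarith

theorem sub_le_sSup_sub_sInf {s : Set ℝ} (hb : BddBelow s) (ha : BddAbove s) {x y : ℝ}
    (hx : x ∈ s) (hy : y ∈ s) : x - y ≤ sSup s - sInf s := by
  linarith [le_csSup ha hx, csInf_le hb hy]

/-! ### Hardware clocks -/

namespace IsClock

variable {M : Model} {H h : ℝ → ℝ}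

theorem exists_slope (hc : IsClock M H h) {s t : ℝ} (hs : 0 ≤ s) (hst : s < t) :
    ∃ x ∈ Ioo s t, H t - H s = h x * (t - s) := by
  have hcont : ContinuousOn H (Icc s t) := fun x hx =>
    ((hc.deriv x (hs.trans hx.1)).continuousWithinAt).mono fun y hy => hs.trans hy.1
  obtain ⟨x, hx, hxs⟩ := exists_hasDerivAt_eq_slope H h hst hcont fun x hx =>
    (hc.deriv x (hs.trans hx.1.le)).hasDerivAt (Ici_mem_nhds (lt_of_le_of_lt hs hx.1))
  refine ⟨x, hx, ?_⟩
  rw [hxs]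
  field_simp [(sub_pos.2 hst).ne']

/-- Local time differences determine time differences up to the drift. -/
theorem gap (hc : IsClock M H h) (hM : M.Valid) {s t c : ℝ} (hs : 0 ≤ s) (ht : 0 ≤ t)
    (hH : H t = H s + c) (h0 : 0 ≤ c) : c / M.ϑ ≤ t - s ∧ t - s ≤ c := by
  have hϑ : 0 < M.ϑ := by linarith [hM.one_lt]
  rw [div_le_iff₀ hϑ]
  rcases lt_trichotomy s t with h | h | h
  · have := hc.drift s t hs h
    constructor <;> nlinarith
  · subst h
    have : c = 0 := by linarith
    subst this; simp
  · have := hc.drift t s ht h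
    exfalso; linarith

/-- The adjusted clock runs at rate μh, between 1 and ϑ²·ϑ = ϑ̄. -/
theorem gap_scaled (hc : IsClock M H h) (hM : M.Valid) {s t τ μ : ℝ} (hs : 0 ≤ s) (ht : 0 ≤ t)
    (hμ : μ ∈ Icc 1 (M.ϑ ^ 2)) (hH : H t = H s + τ / μ) (h0 : 0 ≤ τ) :
    τ / M.vbar ≤ t - s ∧ t - s ≤ τ := by
  have hϑ : 1 < M.ϑ := hM.one_lt
  have hμ0 : 0 < μ := by linarith [hμ.1]
  obtain ⟨h1, h2⟩ := hc.gap hM hs ht hH (by positivity)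
  constructor
  · refine le_trans ?_ h1
    rw [div_div, Model.vbar]
    refine div_le_div_of_nonneg_left h0 (by positivity) ?_
    have := mul_le_mul_of_nonneg_right hμ.2 (by linarith : 0 ≤ M.ϑ)
    linarith [this, (by ring : M.ϑ ^ 3 = M.ϑ ^ 2 * M.ϑ)]
  · exact h2.trans (div_le_self h0 hμ.1)

/-- Accuracy of the normalized measurement of a time difference. -/
theorem abs_measure_sub_le (hc : IsClock M H h) (hM : M.Valid) {s t : ℝ} (hs : 0 ≤ s)
    (ht : 0 ≤ t) :
    |2 * (H t - H s) / (M.ϑ + 1) - (t - s)| ≤ (M.ϑ - 1) / (M.ϑ + 1) * |t - s| := by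
  have hϑ : 1 < M.ϑ := hM.one_lt
  have h1 : 0 < M.ϑ + 1 := by linarith
  -- Dividing by (ϑ+1)/2, the midpoint of the possible rates, makes the relative error symmetric
  -- about 0.
  have e : 2 * (H t - H s) / (M.ϑ + 1) - (t - s)
      = (2 * (H t - H s) - (M.ϑ + 1) * (t - s)) / (M.ϑ + 1) := by field_simp
  rw [e, abs_div, abs_of_pos h1, div_mul_eq_mul_div]
  refine div_le_div_of_nonneg_right ?_ h1.le
  rcases lt_trichotomy s t with h | h | h
  · have := hc.drift s t hs h
    rw [abs_of_pos (sub_pos.2 h), abs_le]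
    constructor <;> linarith
  · subst h; simp
  · have := hc.drift t s ht h
    rw [abs_of_neg (sub_neg.2 h), abs_le]
    constructor <;> linarith

end IsClock

/-! ### Numerical bounds from ᾱ < 1, and consequences of the constraints -/

/-- The smallness of the drift that `ᾱ < 1` amounts to. -/
theorem Model.vbar_lt {M : Model} (hM : M.Valid) (h : M.alphaBar < 1) : M.vbar < 1.06 := by
  have h1 : 1 < M.vbar := one_lt_pow₀ hM.one_lt (by norm_num)
  unfold Model.alphaBar Model.betaBar at h
  set x := M.vbar
  have h2 : (2 * x ^ 2 + 5 * x - 5) / (2 * (x + 1)) < 1 - (4 * x + 3) * (x - 1) := by linarith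
  rw [div_lt_iff₀ (by linarith)] at h2
  -- The hypothesis amounts to 8x³ + 8x² - 5x - 13 < 0, and this cubic is increasing for x ≥ 1 and
  -- positive at 1.06.
  by_contra! hx
  norm_num at hx
  nlinarith [mul_nonneg (sub_nonneg.2 hx) (sub_nonneg.2 hx),
    mul_nonneg (mul_nonneg (sub_nonneg.2 hx) (sub_nonneg.2 hx)) (sub_nonneg.2 hx)]

theorem Model.ϑ_lt {M : Model} (hM : M.Valid) (h : M.alphaBar < 1) : M.ϑ < 1.02 := by
  have h1 := Model.vbar_lt hM h
  by_contra! hx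
  have : (1.02 : ℝ) ^ 3 ≤ M.ϑ ^ 3 := pow_le_pow_left₀ (by norm_num) hx 3
  unfold Model.vbar at h1
  norm_num at *
  linarith

theorem Model.one_lt_vbar {M : Model} (hM : M.Valid) : 1 < M.vbar :=
  one_lt_pow₀ hM.one_lt (by norm_num)

theorem Model.alphaBar_lt_one {M : Model} (hM : M.Valid) (h : M.ϑ ≤ 1.01) : M.alphaBar < 1 := by
  have h1 := Model.one_lt_vbar hM
  have h2 : M.vbar ≤ 1.031 := by
    have : M.ϑ ^ 3 ≤ (1.01 : ℝ) ^ 3 := pow_le_pow_left₀ (by linarith [hM.one_lt]) h 3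
    unfold Model.vbar; norm_num at *; linarith
  unfold Model.alphaBar Model.betaBar
  set x := M.vbar
  have : (2 * x ^ 2 + 5 * x - 5) / (2 * (x + 1)) < 1 - (4 * x + 3) * (x - 1) := by
    rw [div_lt_iff₀ (by linarith)]
    norm_num at h2
    nlinarith [mul_nonneg (sub_nonneg.2 h1.le) (sub_nonneg.2 h2),
      mul_nonneg (mul_nonneg (sub_nonneg.2 h1.le) (sub_nonneg.2 h2)) (sub_nonneg.2 h1.le)]
  linarith

theorem Model.alpha_lt {M : Model} (hM : M.Valid) (h : M.alphaBar < 1) : M.alpha < 0.7 := by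
  have h1 := Model.one_lt_vbar hM
  have h2 := Model.vbar_lt hM h
  unfold Model.alpha
  rw [div_lt_iff₀ (by linarith)]
  norm_num at *
  nlinarith

theorem Model.alpha_nonneg {M : Model} (hM : M.Valid) : 0 ≤ M.alpha := by
  have h1 := Model.one_lt_vbar hM
  unfold Model.alpha
  exact div_nonneg (by nlinarith) (by linarith)

theorem Model.betaBar_lt {M : Model} (hM : M.Valid) (h : M.alphaBar < 1) :
    M.betaBar < 0.62 := by
  have h1 := Model.one_lt_vbar hM
  have h2 := Model.vbar_lt hM h
  unfold Model.betaBar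
  rw [div_lt_iff₀ (by linarith)]
  norm_num at *
  nlinarith

/-- An execution of a properly tuned algorithm in a system of sufficiently small drift. -/
structure Setup (M : Model) (A : Tuning) {n : ℕ} (R : Run n) : Prop where
  valid : M.Valid
  small : M.alphaBar < 1
  constr : Constraints M A
  exec : IsExecution M A R

/-- The constraint on τ₁ and the first term of the maximum give e(1) ≥ F + (ϑ̄-1)e(1). As ϑ̄ < 2 and
F > 0, positivity follows without assuming the sign of any waiting time. -/
theorem e₁_pos {M : Model} {A : Tuning} (hM : M.Valid) (hα : M.alphaBar < 1)
    (hA : Constraints M A) : 0 < e₁ M A := by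
  have h1 := Model.one_lt_vbar hM
  have h2 := Model.vbar_lt hM hα
  have h3 : M.F + (1 - 1 / M.vbar) * A.τ₁ ≤ e₁ M A := le_max_left _ _
  have h4 := hA.τ₁_ge
  have h5 : 0 ≤ 1 - 1 / M.vbar := by
    rw [sub_nonneg, div_le_one (by linarith)]; exact h1.le
  have h6 : (1 - 1 / M.vbar) * (M.vbar * e₁ M A) = (M.vbar - 1) * e₁ M A := by field_simp
  have h7 := mul_le_mul_of_nonneg_left h4 h5
  have h8 := hM.F_pos
  norm_num at h2
  nlinarith

/-- The constraints on the waiting times, in terms of the slowest possible clock. -/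
theorem Constraints.waits {M : Model} {A : Tuning} (hM : M.Valid) (hα : M.alphaBar < 1)
    (hA : Constraints M A) :
    e₁ M A ≤ A.τ₁ / M.vbar ∧ e₁ M A + M.d ≤ A.τ₂ / M.vbar ∧
    e₁ M A + (A.τ₁ - A.τ₁ / M.vbar) + (A.τ₂ - A.τ₂ / M.vbar) ≤ A.τ₃ / M.vbar ∧
    e₁ M A + M.d + (A.τ₂ - A.τ₂ / M.vbar) + (A.τ₃ - A.τ₃ / M.vbar) ≤ A.τ₄ / M.vbar ∧
    0 < A.τ₁ / M.vbar ∧ 0 < A.τ₂ / M.vbar ∧ 0 < A.τ₃ / M.vbar ∧ 0 < A.τ₄ / M.vbar ∧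
    A.τ₁ / M.vbar ≤ A.τ₁ ∧ A.τ₂ / M.vbar ≤ A.τ₂ ∧ A.τ₃ / M.vbar ≤ A.τ₃ ∧
    A.τ₄ / M.vbar ≤ A.τ₄ := by
  have h1 := Model.one_lt_vbar hM
  have h0 : 0 < M.vbar := by linarith
  have he := e₁_pos hM hα hA
  have hd : 0 ≤ M.d := hM.U_nonneg.trans hM.U_le
  have conv : ∀ x y : ℝ, M.vbar * x ≤ y → x ≤ y / M.vbar := fun x y h => by
    rw [le_div_iff₀ h0]; linarith
  have small : ∀ y : ℝ, 0 < y / M.vbar → y / M.vbar ≤ y := fun y h => by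
    have : 0 < y := by
      by_contra! hy
      exact absurd h (not_lt.2 (div_nonpos_of_nonpos_of_nonneg hy h0.le))
    exact div_le_self this.le h1.le
  have a1 := conv _ _ hA.τ₁_ge
  have a2 := conv _ _ hA.τ₂_ge
  have a3 := conv _ _ hA.τ₃_ge
  have a4 := conv _ _ hA.τ₄_ge
  have b3 : (1 - 1 / M.vbar) * (A.τ₁ + A.τ₂)
      = (A.τ₁ - A.τ₁ / M.vbar) + (A.τ₂ - A.τ₂ / M.vbar) := by ring
  have b4 : (1 - 1 / M.vbar) * (A.τ₂ + A.τ₃)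
      = (A.τ₂ - A.τ₂ / M.vbar) + (A.τ₃ - A.τ₃ / M.vbar) := by ring
  have c1 : 0 < A.τ₁ / M.vbar := by linarith
  have c2 : 0 < A.τ₂ / M.vbar := by linarith
  have d1 := small _ c1
  have d2 := small _ c2
  have c3 : 0 < A.τ₃ / M.vbar := by linarith
  have d3 := small _ c3
  have c4 : 0 < A.τ₄ / M.vbar := by linarith
  exact ⟨a1, a2, by linarith, by linarith, c1, c2, c3, c4, d1, d2, d3, small _ c4⟩

theorem Constraints.round_length {M : Model} {A : Tuning} (hM : M.Valid) (hα : M.alphaBar < 1)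
    (hA : Constraints M A) :
    5 * e₁ M A + 2 * M.d + M.U ≤ A.T ∧ A.τ₂ ≤ A.T ∧
      A.τ₁ + A.τ₂ + A.τ₃ + A.τ₄ + e₁ M A + M.U ≤ A.T := by
  obtain ⟨a1, a2, a3, a4, c1, c2, c3, c4, d1, d2, d3, d4⟩ := hA.waits hM hα
  have h1 := Model.one_lt_vbar hM
  have he := e₁_pos hM hα hA
  have hT := hA.T_ge
  have hU := hM.U_nonneg
  have hd := hM.U_le
  have : e₁ M A + M.U ≤ M.vbar * (e₁ M A + M.U) := by nlinarith
  refine ⟨by linarith, by linarith, by linarith⟩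

theorem pullBack_mem {ϑ : ℝ} (hϑ : 1 < ϑ) (ε m : ℝ) : pullBack ϑ ε m ∈ Icc 1 (ϑ ^ 2) := by
  have : 1 ≤ ϑ ^ 2 := one_le_pow₀ hϑ.le
  unfold pullBack
  split_ifs
  · exact ⟨le_max_left _ _, max_le this (min_le_left _ _)⟩
  · exact ⟨le_max_left _ _, max_le this (min_le_left _ _)⟩

/-! ### Order of events and arrival of pulses -/

namespace Setup

variable {M : Model} {A : Tuning} {n : ℕ} {R : Run n}

theorem nonempty (hS : Setup M A R) : R.C.Nonempty := by
  have h1 := hS.exec.n_pos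
  have h2 := maxFaults_lt h1
  have h3 := hS.exec.faults
  rw [Finset.card_compl, Fintype.card_fin] at h3
  exact Finset.card_pos.1 (by omega)

theorem μ_mem (hS : Setup M A R) {v : Fin n} (hv : v ∈ R.C) (r : ℕ) :
    R.μ v r ∈ Icc 1 (M.ϑ ^ 2) := by
  have hϑ := hS.valid.one_lt
  have h2 : M.ϑ ∈ Icc 1 (M.ϑ ^ 2) := ⟨hϑ.le, by nlinarith⟩
  match r with
  | 0 => rw [hS.exec.μ_zero v hv]; exact h2
  | 1 => rw [hS.exec.μ_one v hv]; exact h2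
  | r + 2 =>
    rw [hS.exec.rate v hv (r + 1) (by omega)]
    exact pullBack_mem hϑ _ _

/-- The order of the events of a round, and the times between them. -/
theorem round_times (hS : Setup M A R) {v : Fin n} (hv : v ∈ R.C) {r : ℕ} (hr : 1 ≤ r) :
    (A.τ₁ / M.vbar ≤ R.p v r - R.t v (r - 1) ∧ R.p v r - R.t v (r - 1) ≤ A.τ₁) ∧
    (A.τ₂ / M.vbar ≤ R.a v r - R.p v r ∧ R.a v r - R.p v r ≤ A.τ₂) ∧
    (A.τ₂ / M.vbar + A.τ₃ / M.vbar ≤ R.q v r - R.p v r ∧ R.q v r - R.p v r ≤ A.τ₂ + A.τ₃) ∧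
    (A.τ₂ / M.vbar + A.τ₃ / M.vbar + A.τ₄ / M.vbar ≤ R.b v r - R.p v r ∧
      R.b v r - R.p v r ≤ A.τ₂ + A.τ₃ + A.τ₄) ∧
    R.b v r ≤ R.t v r := by
  obtain ⟨-, -, -, -, c1, c2, c3, c4, d1, d2, d3, d4⟩ := hS.constr.waits hS.valid hS.small
  have hc := hS.exec.clock v hv
  have hM := hS.valid
  obtain ⟨ht, hrest⟩ := hS.exec.nonneg v hv r
  obtain ⟨hp, ha, hq, hb⟩ := hrest hr
  have ht' := (hS.exec.nonneg v hv (r - 1)).1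
  have hp1 := hS.exec.pulse₁ v hv r hr
  have ha1 := hS.exec.listen₁ v hv r hr
  have hq1 := hS.exec.pulse₂ v hv r hr
  have hb1 := hS.exec.listen₂ v hv r hr
  rw [← hp1] at ha1 hq1 hb1
  have hμ := hS.μ_mem hv r
  refine ⟨hc.gap_scaled hM ht' hp (hS.μ_mem hv (r - 1)) hp1 (by linarith),
    hc.gap_scaled hM hp ha hμ ha1 (by linarith), ?_, ?_, ?_⟩
  · rw [← add_div]; exact hc.gap_scaled hM hp hq hμ hq1 (by linarith)
  · rw [← add_div, ← add_div]; exact hc.gap_scaled hM hp hb hμ hb1 (by linarith)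
  · have hn := hS.exec.next v hv r hr
    have : R.H v (R.b v r) ≤ R.H v (R.t v r) := hn ▸ le_max_right _ _
    have := hc.gap hM hb ht (add_sub_cancel (R.H v (R.b v r)) (R.H v (R.t v r))).symm
      (by linarith)
    have h3 : 0 ≤ (R.H v (R.t v r) - R.H v (R.b v r)) / M.ϑ :=
      div_nonneg (by linarith) (by linarith [hM.one_lt])
    linarith

theorem t_mono (hS : Setup M A R) {v : Fin n} (hv : v ∈ R.C) : Monotone (R.t v) := by
  refine monotone_nat_of_le_succ fun r => ?_
  obtain ⟨⟨h1, -⟩, -, -, ⟨h2, -⟩, h3⟩ := hS.round_times hv (r := r + 1) (by omega)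
  obtain ⟨-, -, -, -, c1, c2, c3, c4, -⟩ := hS.constr.waits hS.valid hS.small
  rw [Nat.add_sub_cancel] at h1
  linarith

theorem b_le_p (hS : Setup M A R) {v : Fin n} (hv : v ∈ R.C) {r s : ℕ} (hr : 1 ≤ r)
    (hrs : r < s) : R.b v r ≤ R.p v s := by
  obtain ⟨⟨h1, -⟩, -⟩ := hS.round_times hv (r := s) (by omega)
  have h2 := (hS.round_times hv hr).2.2.2.2
  have h3 := hS.t_mono hv (by omega : r ≤ s - 1)
  obtain ⟨-, -, -, -, c1, -⟩ := hS.constr.waits hS.valid hS.small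
  linarith

/-- The pulses of round `r` are sent with skew at most `e(1)`. -/
def Close (M : Model) (A : Tuning) (R : Run n) (r : ℕ) : Prop :=
  ∀ v ∈ R.C, ∀ w ∈ R.C, R.p v r - R.p w r ≤ e₁ M A

/-- If the skew of a round is small, pulses arrive while the nodes listen for them. -/
theorem windows (hS : Setup M A R) {r : ℕ} (hr : 1 ≤ r) (hc : Close M A R r) {v w : Fin n}
    (hv : v ∈ R.C) (hw : w ∈ R.C) :
    R.t v (r - 1) ≤ R.p w r ∧ R.p w r + M.d ≤ R.a v r ∧ R.a v r < R.q w r ∧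
      R.q w r + M.d ≤ R.b v r := by
  obtain ⟨a1, a2, a3, a4, c1, c2, c3, c4, d1, d2, d3, d4⟩ := hS.constr.waits hS.valid hS.small
  obtain ⟨⟨v1, v2⟩, ⟨v3, v4⟩, ⟨v5, v6⟩, ⟨v7, v8⟩, v9⟩ := hS.round_times hv hr
  obtain ⟨⟨w1, w2⟩, ⟨w3, w4⟩, ⟨w5, w6⟩, ⟨w7, w8⟩, w9⟩ := hS.round_times hw hr
  have h1 := hc v hv w hw
  have h2 := hc w hw v hv
  have he := e₁_pos hS.valid hS.small hS.constr
  have h1v := Model.one_lt_vbar hS.valid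
  -- The strictness of `R.a v r < R.q w r` comes from the summand (1-1/ϑ̄)τ₁ in the constraint on
  -- τ₃.
  have h5 : A.τ₁ / M.vbar < A.τ₁ := div_lt_self (by linarith) h1v
  refine ⟨by linarith, by linarith, by linarith, by linarith⟩

/-- All previous rounds went as planned. -/
structure Regular (M : Model) (A : Tuning) (R : Run n) (r : ℕ) : Prop where
  close : ∀ s, 1 ≤ s → s ≤ r → Close M A R s
  late : ∀ s, 1 ≤ s → s < r → ∀ v ∈ R.C, R.b v s < R.t v s

/-- Pulses of earlier rounds have arrived before the round starts, and those of later rounds come no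
earlier than `R.q w r + M.d`. Hence the first arrivals in the two windows are the two pulses of
round r. -/
theorem exists_arrivals (hS : Setup M A R) {r : ℕ} (hr : 1 ≤ r) (hreg : Regular M A R r)
    {v w : Fin n} (hv : v ∈ R.C) (hw : w ∈ R.C) :
    ∃ x ∈ Icc (R.p w r + M.d - M.U) (R.p w r + M.d),
    ∃ y ∈ Icc (R.q w r + M.d - M.U) (R.q w r + M.d),
      R.first w v r = some x ∧ R.second w v r = some y ∧ R.t v (r - 1) ≤ x ∧ x ≤ R.a v r ∧
        R.a v r < y ∧ y ≤ R.b v r := by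
  obtain ⟨x, y, hx, hy, harr⟩ := hS.exec.delivery w hw v hv
  have hU := hS.valid.U_nonneg
  have hd := hS.valid.U_le
  obtain ⟨-, -, -, -, c1, c2, c3, c4, -⟩ := hS.constr.waits hS.valid hS.small
  obtain ⟨win1, win2, win3, win4⟩ := hS.windows hr (hreg.close r hr le_rfl) hv hw
  have hwin4 := (hS.windows hr (hreg.close r hr le_rfl) hw hw).2.2.2
  have hxr := hx r hr
  have hyr := hy r hr
  have hxa : x r ≤ R.a v r := hxr.2.trans win2
  have hta : R.t v (r - 1) ≤ x r := by linarith [hxr.1]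
  have hay : R.a v r < y r := by linarith [hyr.1]
  have hyb : y r ≤ R.b v r := hyr.2.trans win4
  have old : ∀ s, 1 ≤ s → s < r → x s < R.t v (r - 1) ∧ y s < R.t v (r - 1) := by
    intro s hs hsr
    obtain ⟨-, s2, s3, s4⟩ := hS.windows hs (hreg.close s hs hsr.le) hv hw
    have h1 := hreg.late s hs hsr v hv
    have h2 := hS.t_mono hv (by omega : s ≤ r - 1)
    constructor <;> linarith [(hx s hs).2, (hy s hs).2]
  -- Later pulses are not shown to miss the window of `v`. It suffices that their sender has already
  -- finished listening to its own second pulse.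
  have new : ∀ s, r < s → R.q w r + M.d ≤ x s ∧ R.q w r + M.d ≤ y s := by
    intro s hsr
    have h1 := hS.b_le_p hw hr hsr
    obtain ⟨-, -, ⟨h2, -⟩, -, -⟩ := hS.round_times hw (by omega : 1 ≤ s)
    constructor <;> linarith [(hx s (by omega)).1, (hy s (by omega)).1]
  refine ⟨x r, hxr, y r, hyr, firstIn_eq_some ⟨⟨?_, hta, hxa⟩, ?_⟩,
    firstIn_eq_some ⟨⟨?_, hay, hyb⟩, ?_⟩, hta, hxa, hay, hyb⟩
  · rw [harr]; exact ⟨r, hr, Or.inl rfl⟩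
  · rintro z ⟨hz, hz1, hz2⟩
    rw [harr] at hz
    obtain ⟨s, hs, hz⟩ := hz
    rcases lt_trichotomy s r with h | h | h
    · have := old s hs h
      rcases hz with rfl | rfl <;> linarith
    · subst h
      rcases hz with rfl | rfl <;> linarith
    · have := new s h
      rcases hz with rfl | rfl <;> linarith [hxr.2]
  · rw [harr]; exact ⟨r, hr, Or.inr rfl⟩
  · rintro z ⟨hz, hz1, hz2⟩
    rw [harr] at hz
    obtain ⟨s, hs, hz⟩ := hz
    rcases lt_trichotomy s r with h | h | h
    · have := old s hs h
      rcases hz with rfl | rfl <;> linarith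
    · subst h
      rcases hz with rfl | rfl <;> linarith
    · have := new s h
      rcases hz with rfl | rfl <;> linarith [hyr.2]

end Setup

/-- Relative deviation `(ϑ - 1) / (ϑ + 1)` of normalized measurements. -/
def Model.dev (M : Model) : ℝ := (M.ϑ - 1) / (M.ϑ + 1)

theorem Model.dev_bounds {M : Model} (hM : M.Valid) :
    0 ≤ M.dev ∧ M.dev ≤ (M.ϑ - 1) / 2 ∧ M.dev ≤ (M.vbar - 1) / (M.vbar + 1) := by
  have h := hM.one_lt
  have h1 := Model.one_lt_vbar hM
  have h2 : M.ϑ ≤ M.vbar := le_self_pow₀ h.le (by norm_num)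
  unfold Model.dev
  refine ⟨div_nonneg (by linarith) (by linarith),
    div_le_div_of_nonneg_left (by linarith) (by norm_num) (by linarith), ?_⟩
  rw [div_le_div_iff₀ (by linarith) (by linarith)]
  nlinarith

/-- The contraction factors, expanded around `1 / 2`. -/
theorem Model.contraction_bounds {M : Model} (hM : M.Valid) :
    ∃ D : ℝ, M.dev ≤ D ∧ (1 - 1 / M.vbar) * (1 + M.dev) ≤ 2 * D ∧ 1 / 2 + 4 * D ≤ M.betaBar ∧
      1 / 2 + 6 * D ≤ M.alpha ∧ 2 * D ≤ M.vbar - 1 := by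
  have h1 := Model.one_lt_vbar hM
  have h2 := (Model.dev_bounds hM).2.2
  set x := M.vbar with hx
  have hx1 : x + 1 ≠ 0 := by linarith
  have hx0 : x ≠ 0 := by linarith
  -- With this D one has β̄ = 1/2 + (ϑ̄+3)D and α = 1/2 + 2(ϑ̄+2)D, whence the coefficients 4 and 6.
  refine ⟨(x - 1) / (x + 1), h2, ?_, ?_, ?_, ?_⟩
  · have h3 : 0 ≤ 1 - 1 / x := by
      rw [sub_nonneg, div_le_one (by linarith)]; exact h1.le
    calc (1 - 1 / x) * (1 + M.dev) ≤ (1 - 1 / x) * (1 + (x - 1) / (x + 1)) := by gcongr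
      _ = 2 * ((x - 1) / (x + 1)) := by field_simp; ring
  · have : M.betaBar = 1 / 2 + (x - 1) / (x + 1) * (x + 3) := by
      unfold Model.betaBar; rw [← hx]; field_simp; ring
    have h4 : 0 ≤ (x - 1) / (x + 1) := div_nonneg (by linarith) (by linarith)
    rw [this]; nlinarith
  · have : M.alpha = 1 / 2 + (x - 1) / (x + 1) * (2 * (x + 2)) := by
      unfold Model.alpha; rw [← hx]; field_simp; ring
    have h4 : 0 ≤ (x - 1) / (x + 1) := div_nonneg (by linarith) (by linarith)
    rw [this]; nlinarith
  · rw [← mul_div_assoc, div_le_iff₀ (by linarith)]; nlinarith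

/-! ### Phase correction and skew -/

namespace Setup

variable {M : Model} {A : Tuning} {n : ℕ} {R : Run n}

/-- The accuracy of phase measurements when the skew is `S`. -/
def phaseErr (M : Model) (S : ℝ) : ℝ := M.U + M.dev * (S + M.U)

/-- Both arrivals have delays in [d-U, d], so their difference is within U of the difference of
sending times. Measuring it costs a further relative error `M.dev`. -/
theorem exists_phaseCorr_bounds (hS : Setup M A R) {r : ℕ} (hr : 1 ≤ r)
    (hreg : Regular M A R r) {lo hi : ℝ} (hlo : ∀ w ∈ R.C, lo ≤ R.p w r)
    (hhi : ∀ w ∈ R.C, R.p w r ≤ hi) :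
    ∃ m ∈ Icc lo hi, ∀ v ∈ R.C,
      (lo + m) / 2 - R.p v r - phaseErr M (hi - lo) ≤ R.phaseCorr M.ϑ v r ∧
      R.phaseCorr M.ϑ v r ≤ (m + hi) / 2 - R.p v r + phaseErr M (hi - lo) := by
  obtain ⟨m, hm, h⟩ := exists_agree_bounds hS.exec.n_pos hS.exec.faults (fun w => R.p w r) hlo hhi
  refine ⟨m, hm, fun v hv => h _ (R.p v r) (phaseErr M (hi - lo)) fun w hw => ?_⟩
  obtain ⟨x, hx, -, -, hxe, -, hx0, -⟩ := hS.exists_arrivals hr hreg hv hw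
  obtain ⟨y, hy, -, -, hye, -, hy0, -⟩ := hS.exists_arrivals hr hreg hv hv
  refine ⟨_, by rw [hxe, hye]; rfl, ?_⟩
  have ht := (hS.exec.nonneg v hv (r - 1)).1
  have h1 := (hS.exec.clock v hv).abs_measure_sub_le hS.valid (ht.trans hy0) (ht.trans hx0)
  have h2 : |(x - y) - (R.p w r - R.p v r)| ≤ M.U := by
    rw [abs_le]; constructor <;> linarith [hx.1, hx.2, hy.1, hy.2]
  have h3 : |x - y| ≤ hi - lo + M.U := by
    have := hlo w hw; have := hlo v hv; have := hhi w hw; have := hhi v hv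
    rw [abs_le] at h2 ⊢; constructor <;> linarith
  have h4 : (M.ϑ - 1) / (M.ϑ + 1) * |x - y| ≤ M.dev * (hi - lo + M.U) :=
    mul_le_mul_of_nonneg_left h3 (Model.dev_bounds hS.valid).1
  unfold phaseErr
  rw [abs_le] at h1 h2 ⊢
  constructor <;> linarith

/-- Phase corrections are small, and the nodes have time to apply them. -/
theorem next_round (hS : Setup M A R) {r : ℕ} (hr : 1 ≤ r) {v : Fin n} (hv : v ∈ R.C)
    (hΔ : |R.phaseCorr M.ϑ v r| ≤ (1 + M.dev) * (e₁ M A + M.U)) :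
    R.b v r < R.t v r ∧ 0 < A.T + R.phaseCorr M.ϑ v r ∧
      R.H v (R.p v (r + 1))
        = R.H v (R.p v r) + (A.T + R.phaseCorr M.ϑ v r) / R.μ v r := by
  have hM := hS.valid
  have he := e₁_pos hM hS.small hS.constr
  obtain ⟨-, -, -, -, c1, c2, c3, c4, d1, d2, d3, d4⟩ := hS.constr.waits hM hS.small
  have hdev := Model.dev_bounds hM
  have hϑ := hM.one_lt
  have hU := hM.U_nonneg
  have h2 : M.ϑ ≤ M.vbar := le_self_pow₀ hϑ.le (by norm_num)
  have h3 : (1 + M.dev) * (e₁ M A + M.U) < M.vbar * (e₁ M A + M.U) :=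
    mul_lt_mul_of_pos_right (by linarith) (by linarith)
  have hT := hS.constr.T_ge
  set Δ := R.phaseCorr M.ϑ v r
  have hΔ' := (abs_le.1 hΔ).1
  have hμ0 : 0 < R.μ v r := by linarith [(hS.μ_mem hv r).1]
  have hp := hS.exec.pulse₁ v hv r hr
  have hb := hS.exec.listen₂ v hv r hr
  have hn := hS.exec.next v hv r hr
  have hp' := hS.exec.pulse₁ v hv (r + 1) (by omega)
  rw [Nat.add_sub_cancel] at hp'
  rw [← hp] at hb hn
  -- The slack ϑ̄(e(1)+U) in the constraint on T exceeds |Δ|, so the maximum defining the start of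
  -- the next round is its first argument.
  have h5 : (A.τ₂ + A.τ₃ + A.τ₄) / R.μ v r < (A.T + Δ - A.τ₁) / R.μ v r :=
    div_lt_div_of_pos_right (by linarith) hμ0
  rw [max_eq_left (by linarith)] at hn
  refine ⟨?_, by linarith, ?_⟩
  · have h6 := ((hS.exec.clock v hv).gap hM ((hS.exec.nonneg v hv r).2 hr).2.2.2
      (hS.exec.nonneg v hv r).1 (add_sub_cancel (R.H v (R.b v r)) (R.H v (R.t v r))).symm
      (by linarith)).1
    have h7 : 0 < (R.H v (R.t v r) - R.H v (R.b v r)) / M.ϑ :=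
      div_pos (by linarith) (by linarith)
    linarith
  · rw [hp', hn]; ring

theorem abs_phaseCorr_le (hS : Setup M A R) {r : ℕ} (hr : 1 ≤ r)
    (hreg : Regular M A R r) {lo hi : ℝ} (hlo : ∀ w ∈ R.C, lo ≤ R.p w r)
    (hhi : ∀ w ∈ R.C, R.p w r ≤ hi) {v : Fin n} (hv : v ∈ R.C) :
    |R.phaseCorr M.ϑ v r| ≤ (1 + M.dev) * (hi - lo + M.U) := by
  obtain ⟨m, hm, h⟩ := hS.exists_phaseCorr_bounds hr hreg hlo hhi
  have h1 := h v hv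
  have := hlo v hv
  have := hhi v hv
  unfold phaseErr at h1
  rw [abs_le]
  constructor <;> linarith [hm.1, hm.2]

theorem exists_extremes (hS : Setup M A R) (r : ℕ) :
    ∃ x ∈ R.C, ∃ y ∈ R.C, (∀ w ∈ R.C, R.p x r ≤ R.p w r) ∧ ∀ w ∈ R.C, R.p w r ≤ R.p y r := by
  obtain ⟨x, hx, h1⟩ := R.C.exists_min_image (fun w => R.p w r) hS.nonempty
  obtain ⟨y, hy, h2⟩ := R.C.exists_max_image (fun w => R.p w r) hS.nonempty
  exact ⟨x, hx, y, hy, h1, h2⟩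

theorem abs_phaseCorr_le_e₁ (hS : Setup M A R) {r : ℕ} (hr : 1 ≤ r)
    (hreg : Regular M A R r) {v : Fin n} (hv : v ∈ R.C) :
    |R.phaseCorr M.ϑ v r| ≤ (1 + M.dev) * (e₁ M A + M.U) := by
  obtain ⟨x, hx, y, hy, hlo, hhi⟩ := hS.exists_extremes r
  refine (hS.abs_phaseCorr_le hr hreg hlo hhi hv).trans ?_
  have := hreg.close r hr le_rfl y hy x hx
  exact mul_le_mul_of_nonneg_left (by linarith) (by linarith [(Model.dev_bounds hS.valid).1])

theorem close_one (hS : Setup M A R) : Close M A R 1 := by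
  have hM := hS.valid
  have hϑ := hM.one_lt
  obtain ⟨-, -, -, -, c1, c2, c3, c4, d1, -⟩ := hS.constr.waits hM hS.small
  have key : ∀ v ∈ R.C, A.τ₁ / M.ϑ / M.ϑ ≤ R.p v 1 ∧ R.p v 1 ≤ M.F + A.τ₁ / M.ϑ := by
    intro v hv
    have hc := hS.exec.clock v hv
    have ht := (hS.exec.nonneg v hv 0).1
    have hp := ((hS.exec.nonneg v hv 1).2 le_rfl).1
    have h1 := hS.exec.pulse₁ v hv 1 le_rfl
    have h0 := hS.exec.start v hv
    rw [Nat.sub_self, hS.exec.μ_zero v hv] at h1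
    obtain ⟨g1, g2⟩ := hc.gap hM ht hp h1 (div_nonneg (by linarith) (by linarith))
    obtain ⟨-, g4⟩ := hc.gap hM le_rfl ht
      (add_sub_cancel (R.H v 0) (R.H v (R.t v 0))).symm (by linarith [hc.init.2])
    constructor <;> linarith [hc.init.1]
  intro v hv w hw
  have hv' := (key v hv).2
  have hw' := (key w hw).1
  refine le_trans ?_ (le_max_left _ _)
  have h1v : 1 / M.ϑ ≤ 1 := by rw [div_le_one (by linarith)]; exact hϑ.le
  have h0v : 0 < 1 / M.ϑ := div_pos one_pos (by linarith)
  have e1 : A.τ₁ / M.ϑ - A.τ₁ / M.ϑ / M.ϑ = A.τ₁ * (1 / M.ϑ - (1 / M.ϑ) ^ 2) := by ring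
  have e2 : 1 / M.vbar = (1 / M.ϑ) ^ 3 := by unfold Model.vbar; rw [one_div_pow]
  have e3 : 1 / M.ϑ - (1 / M.ϑ) ^ 2 ≤ 1 - (1 / M.ϑ) ^ 3 := by
    set z := 1 / M.ϑ
    nlinarith [pow_pos h0v 2, mul_nonneg (pow_pos h0v 2).le (sub_nonneg.2 h1v)]
  have := mul_le_mul_of_nonneg_left e3 (by linarith : 0 ≤ A.τ₁)
  rw [e2]
  linarith

/-- Agreement contributes S/2 and two measurement errors. Rates between 1 and ϑ̄ add (1-1/ϑ̄)T and a
distortion of one correction by at most 2D(S+U). The total is at most β̄e(1) + (1-1/ϑ̄)T + (3ϑ̄-1)U,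
which the second term of the maximum in e(1) keeps below e(1). -/
theorem close_succ (hS : Setup M A R) {r : ℕ} (hr : 1 ≤ r) (hreg : Regular M A R r) :
    Close M A R (r + 1) := by
  have hM := hS.valid
  obtain ⟨x, hx, y, hy, hlo, hhi⟩ := hS.exists_extremes r
  obtain ⟨m, hm, h⟩ := hS.exists_phaseCorr_bounds hr hreg hlo hhi
  have hclose := hreg.close r hr le_rfl y hy x hx
  obtain ⟨D, D1, D2, D3, -, D5⟩ := Model.contraction_bounds hM
  have hdev := (Model.dev_bounds hM).1
  have h1 := Model.one_lt_vbar hM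
  have hU := hM.U_nonneg
  have he := e₁_pos hM hS.small hS.constr
  have hβ := Model.betaBar_lt hM hS.small
  intro v hv w hw
  set S := R.p y r - R.p x r
  have hS0 : 0 ≤ S := sub_nonneg.2 (hlo y hy)
  have hv1 := hS.next_round hr hv (hS.abs_phaseCorr_le_e₁ hr hreg hv)
  have hw1 := hS.next_round hr hw (hS.abs_phaseCorr_le_e₁ hr hreg hw)
  have hΔw := (abs_le.1 (hS.abs_phaseCorr_le hr hreg hlo hhi hw)).2
  have gv := ((hS.exec.clock v hv).gap_scaled hM ((hS.exec.nonneg v hv r).2 hr).1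
    ((hS.exec.nonneg v hv (r + 1)).2 (by omega)).1 (hS.μ_mem hv r) hv1.2.2 hv1.2.1.le).2
  have gw := ((hS.exec.clock w hw).gap_scaled hM ((hS.exec.nonneg w hw r).2 hr).1
    ((hS.exec.nonneg w hw (r + 1)).2 (by omega)).1 (hS.μ_mem hw r) hw1.2.2 hw1.2.1.le).1
  have bv := (h v hv).2
  have bw := (h w hw).1
  set Δv := R.phaseCorr M.ϑ v r
  set Δw := R.phaseCorr M.ϑ w r
  have h3 : 0 ≤ 1 - 1 / M.vbar := by
    rw [sub_nonneg, div_le_one (by linarith)]; exact h1.le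
  have q1 : (A.T + Δw) / M.vbar = (A.T + Δw) - (1 - 1 / M.vbar) * A.T
      - (1 - 1 / M.vbar) * Δw := by ring
  have q2 : (1 - 1 / M.vbar) * Δw ≤ 2 * D * (S + M.U) := by
    calc (1 - 1 / M.vbar) * Δw ≤ (1 - 1 / M.vbar) * ((1 + M.dev) * (S + M.U)) := by gcongr
      _ = (1 - 1 / M.vbar) * (1 + M.dev) * (S + M.U) := by ring
      _ ≤ 2 * D * (S + M.U) := by gcongr
  have q3 : M.dev * (S + M.U) ≤ D * (S + M.U) := by gcongr
  have q4 : (1 - 1 / M.vbar) * A.T + (3 * M.vbar - 1) * M.U ≤ e₁ M A * (1 - M.betaBar) := by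
    rw [← div_le_iff₀ (by norm_num at hβ; linarith)]; exact le_max_right _ _
  have q5 : (1 / 2 + 4 * D) * S ≤ M.betaBar * e₁ M A :=
    mul_le_mul D3 hclose hS0 (by linarith)
  have q6 : 4 * D * M.U ≤ (3 * M.vbar - 3) * M.U :=
    mul_le_mul_of_nonneg_right (by linarith) hU
  unfold phaseErr at bv bw
  linarith

theorem regular (hS : Setup M A R) (r : ℕ) : Regular M A R r := by
  induction r with
  | zero => exact ⟨fun s h1 h2 => by omega, fun s h1 h2 => by omega⟩
  | succ r ih =>
    rcases Nat.eq_zero_or_pos r with rfl | hr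
    · refine ⟨fun s h1 h2 => ?_, fun s h1 h2 => by omega⟩
      obtain rfl : s = 1 := by omega
      exact hS.close_one
    · refine ⟨fun s h1 h2 => ?_, fun s h1 h2 v hv => ?_⟩
      · rcases Nat.lt_or_ge r s with h | h
        · obtain rfl : s = r + 1 := by omega
          exact hS.close_succ hr ih
        · exact ih.close s h1 h
      · rcases Nat.lt_or_ge s r with h | h
        · exact ih.late s h1 h v hv
        · obtain rfl : s = r := by omega
          exact (hS.next_round hr hv (hS.abs_phaseCorr_le_e₁ hr ih hv)).1

theorem mul_clock_rate_mem (hS : Setup M A R) {v : Fin n} (hv : v ∈ R.C) (r : ℕ) {s : ℝ}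
    (hs : 0 ≤ s) : R.μ v r * R.h v s ∈ Icc 1 M.vbar := by
  have hμ := hS.μ_mem hv r
  have hh := (hS.exec.clock v hv).rate s hs
  constructor
  · nlinarith [hμ.1, hh.1]
  · have : M.vbar = M.ϑ ^ 2 * M.ϑ := by unfold Model.vbar; ring
    rw [this]
    exact mul_le_mul hμ.2 hh.2 (by linarith [hh.1]) (by positivity)

theorem rates_subset (hS : Setup M A R) {r : ℕ} (hr : 1 ≤ r) : R.rates r ⊆ Icc 1 M.vbar := by
  rintro _ ⟨v, hv, s, hs, rfl⟩
  exact hS.mul_clock_rate_mem hv r ((((hS.exec.nonneg v hv r).2 hr).1).trans hs.1)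

/-- The length of a round, in terms of the average rate of the adjusted clock. -/
theorem exists_round_rate (hS : Setup M A R) {r : ℕ} (hr : 1 ≤ r) {v : Fin n} (hv : v ∈ R.C) :
    R.p v r < R.p v (r + 1) ∧ ∃ s ∈ Ioo (R.p v r) (R.p v (r + 1)),
      R.μ v r * R.h v s * (R.p v (r + 1) - R.p v r) = A.T + R.phaseCorr M.ϑ v r := by
  obtain ⟨-, h2, h3⟩ := hS.next_round hr hv (hS.abs_phaseCorr_le_e₁ hr (hS.regular r) hv)
  have hc := hS.exec.clock v hv
  have hp := ((hS.exec.nonneg v hv r).2 hr).1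
  have hμ0 : 0 < R.μ v r := by linarith [(hS.μ_mem hv r).1]
  have hlt : R.p v r < R.p v (r + 1) := by
    have h4 := (hc.gap_scaled hS.valid hp ((hS.exec.nonneg v hv (r + 1)).2 (by omega)).1
      (hS.μ_mem hv r) h3 h2.le).1
    have : 0 < (A.T + R.phaseCorr M.ϑ v r) / M.vbar :=
      div_pos h2 (by linarith [Model.one_lt_vbar hS.valid])
    linarith
  obtain ⟨s, hs, hsl⟩ := hc.exists_slope hp hlt
  refine ⟨hlt, s, hs, ?_⟩
  rw [mul_assoc, ← hsl, h3]
  field_simp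
  ring

theorem skew_le (hS : Setup M A R) {r : ℕ} {B : ℝ}
    (h : ∀ v ∈ R.C, ∀ w ∈ R.C, R.p v r - R.p w r ≤ B) : R.skew r ≤ B := by
  refine sSup_sub_sInf_le ((Finset.coe_nonempty.2 hS.nonempty).image _) ?_
  rintro _ ⟨v, hv, rfl⟩ _ ⟨w, hw, rfl⟩
  exact h v hv w hw

theorem le_skew (R : Run n) (r : ℕ) {v w : Fin n} (hv : v ∈ R.C) (hw : w ∈ R.C) :
    R.p v r - R.p w r ≤ R.skew r := by
  have hf : ((fun v => R.p v r) '' (R.C : Set (Fin n))).Finite := R.C.finite_toSet.image _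
  exact sub_le_sSup_sub_sInf hf.bddBelow hf.bddAbove ⟨v, hv, rfl⟩ ⟨w, hw, rfl⟩

theorem le_rateSpread (hS : Setup M A R) {r : ℕ} (hr : 1 ≤ r) {x y : ℝ} (hx : x ∈ R.rates r)
    (hy : y ∈ R.rates r) : x - y ≤ R.rateSpread r :=
  sub_le_sSup_sub_sInf (bddBelow_Icc.mono (hS.rates_subset hr))
    (bddAbove_Icc.mono (hS.rates_subset hr)) hx hy

/-- Here T enters only through the difference of inverse rates, at most the rate spread because
rates are at least 1. In exchange the distortion of both corrections must be estimated, so 6D and α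
replace 4D and β̄. -/
theorem skew_succ_le (hS : Setup M A R) {r : ℕ} (hr : 1 ≤ r) :
    R.skew (r + 1) ≤ M.alpha * R.skew r
      + ((4 * M.vbar - 2) * M.U + A.T * R.rateSpread r) := by
  have hM := hS.valid
  have hreg := hS.regular r
  obtain ⟨x, hx, y, hy, hlo, hhi⟩ := hS.exists_extremes r
  obtain ⟨m, hm, h⟩ := hS.exists_phaseCorr_bounds hr hreg hlo hhi
  obtain ⟨D, D1, D2, -, D4, D5⟩ := Model.contraction_bounds hM
  have hdev := (Model.dev_bounds hM).1
  have h1 := Model.one_lt_vbar hM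
  have hU := hM.U_nonneg
  have hsk := le_skew R r hy hx
  have hT : 0 ≤ A.T := by
    linarith [(hS.constr.round_length hM hS.small).1, e₁_pos hM hS.small hS.constr, hM.U_le]
  refine hS.skew_le fun v hv w hw => ?_
  set S := R.p y r - R.p x r
  have hS0 : 0 ≤ S := sub_nonneg.2 (hlo y hy)
  have h3 : 0 ≤ 1 - 1 / M.vbar := by
    rw [sub_nonneg, div_le_one (by linarith)]; exact h1.le
  have len : ∀ u ∈ R.C, ∃ ρ ∈ R.rates r, R.p u (r + 1) - R.p u r
      = A.T * (1 / ρ) + R.phaseCorr M.ϑ u r * (1 / ρ) ∧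
      |R.phaseCorr M.ϑ u r * (1 - 1 / ρ)| ≤ 2 * D * (S + M.U) := by
    intro u hu
    obtain ⟨-, s, hs, hl⟩ := hS.exists_round_rate hr hu
    have hmem : R.μ u r * R.h u s ∈ R.rates r := ⟨u, hu, s, Ioo_subset_Icc_self hs, rfl⟩
    refine ⟨_, hmem, ?_, ?_⟩
    · have := (hS.rates_subset hr hmem).1
      rw [← add_mul, mul_one_div, eq_div_iff (by linarith), ← hl]; ring
    · have hΔ := hS.abs_phaseCorr_le hr hreg hlo hhi hu
      have hρ := hS.rates_subset hr hmem
      set ρ := R.μ u r * R.h u s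
      have g1 : 1 / M.vbar ≤ 1 / ρ := one_div_le_one_div_of_le (by linarith [hρ.1]) hρ.2
      have g2 : 1 / ρ ≤ 1 := by rw [div_le_one (by linarith [hρ.1])]; exact hρ.1
      rw [abs_mul, abs_of_nonneg (by linarith : 0 ≤ 1 - 1 / ρ)]
      calc |R.phaseCorr M.ϑ u r| * (1 - 1 / ρ)
          ≤ ((1 + M.dev) * (S + M.U)) * (1 - 1 / M.vbar) := by gcongr
        _ = (1 - 1 / M.vbar) * (1 + M.dev) * (S + M.U) := by ring
        _ ≤ 2 * D * (S + M.U) := by gcongr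
  obtain ⟨ρv, hρv, lv, ev⟩ := len v hv
  obtain ⟨ρw, hρw, lw, ew⟩ := len w hw
  have bv := (h v hv).2
  have bw := (h w hw).1
  have sp := hS.le_rateSpread hr hρw hρv
  have sp0 := hS.le_rateSpread hr hρw hρw
  have hv1 := (hS.rates_subset hr hρv).1
  have hw1 := (hS.rates_subset hr hρw).1
  have inv : 1 / ρv - 1 / ρw ≤ R.rateSpread r := by
    have : 1 / ρv - 1 / ρw = (ρw - ρv) / (ρv * ρw) := by field_simp
    rw [this, div_le_iff₀ (by positivity)]
    have : 1 ≤ ρv * ρw := by nlinarith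
    nlinarith
  have q0 : A.T * (1 / ρv) - A.T * (1 / ρw) ≤ A.T * R.rateSpread r := by
    rw [← mul_sub]; exact mul_le_mul_of_nonneg_left inv hT
  have q3 : M.dev * (S + M.U) ≤ D * (S + M.U) := by gcongr
  have q5 : (1 / 2 + 6 * D) * S ≤ M.alpha * R.skew r :=
    mul_le_mul D4 hsk hS0 (Model.alpha_nonneg hM)
  have q6 : 6 * D * M.U ≤ (4 * M.vbar - 4) * M.U :=
    mul_le_mul_of_nonneg_right (by linarith) hU
  rw [abs_le] at ev ew
  unfold phaseErr at bv bw
  linarith [ev.1, ew.2]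

end Setup

/-! ### The pull-back of multipliers -/

/-- Restriction from above by ϑ² only helps an upper bound; only raising the value to 1 can violate
it. -/
theorem pullBack_cases_le {ϑ : ℝ} (ε m : ℝ) (hε : 0 ≤ ε) :
    pullBack ϑ ε m ≤ m + ε ∨ pullBack ϑ ε m = 1 := by
  unfold pullBack
  split_ifs
  · rcases max_choice 1 (min (ϑ ^ 2) (m + ε)) with h | h
    · exact Or.inr h
    · rw [h]; exact Or.inl (min_le_right _ _)
  · rcases max_choice 1 (min (ϑ ^ 2) (m - ε)) with h | h
    · exact Or.inr h
    · rw [h]; exact Or.inl ((min_le_right _ _).trans (by linarith))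

theorem pullBack_cases_ge {ϑ : ℝ} (ε m : ℝ) (hε : 0 ≤ ε) :
    m - ε ≤ pullBack ϑ ε m ∨ ϑ ^ 2 ≤ pullBack ϑ ε m := by
  unfold pullBack
  split_ifs
  · rcases min_choice (ϑ ^ 2) (m + ε) with h | h <;> rw [h]
    · exact Or.inr (le_max_right _ _)
    · exact Or.inl (le_trans (by linarith) (le_max_right _ _))
  · rcases min_choice (ϑ ^ 2) (m - ε) with h | h <;> rw [h]
    · exact Or.inr (le_max_right _ _)
    · exact Or.inl (le_max_right _ _)

/-- The pull-back keeps adjusted rates within `ϑ ε` of the range `[ϑ, ϑ²]`. -/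
theorem pullBack_mul_le {ϑ ε m g κ hi : ℝ} (hϑ : 1 < ϑ) (hε : 0 ≤ ε) (hg : g ∈ Icc 1 ϑ)
    (hκ : κ ≤ ε) (hhi : hi ≤ ϑ ^ 2 + ε * ϑ) (hm : m * g ≤ hi + κ) :
    pullBack ϑ ε m * g ≤ ϑ ^ 2 + ε * ϑ := by
  obtain ⟨hg1, hg2⟩ := hg
  have hεϑ : 0 ≤ ε * ϑ := by positivity
  -- A multiplier pulled up is at most ϑ+ε, hence its rate at most (ϑ+ε)ϑ. One pulled down without
  -- hitting 1 loses at least ε in rate, which absorbs the error κ.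
  by_cases h : m ≤ ϑ
  · have : pullBack ϑ ε m ≤ ϑ + ε := by
      rw [pullBack, if_pos h]
      exact max_le (by linarith) ((min_le_right _ _).trans (by linarith))
    calc pullBack ϑ ε m * g ≤ (ϑ + ε) * ϑ := by gcongr
      _ = ϑ ^ 2 + ε * ϑ := by ring
  · have h1 : pullBack ϑ ε m = 1 ∨ pullBack ϑ ε m ≤ m - ε := by
      rw [pullBack, if_neg h]
      rcases max_choice 1 (min (ϑ ^ 2) (m - ε)) with h | h
      · exact Or.inl h
      · rw [h]; exact Or.inr (min_le_right _ _)
    rcases h1 with h1 | h1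
    · rw [h1]; nlinarith
    · have := mul_le_mul_of_nonneg_right h1 (by linarith : 0 ≤ g)
      nlinarith

theorem le_pullBack_mul {ϑ ε m g κ lo : ℝ} (hϑ : 1 < ϑ) (hε : 0 ≤ ε) (hg : g ∈ Icc 1 ϑ)
    (hκ : κ ≤ ε) (hlo : ϑ - ε * ϑ ≤ lo) (hm : lo - κ ≤ m * g) :
    ϑ - ε * ϑ ≤ pullBack ϑ ε m * g := by
  obtain ⟨hg1, hg2⟩ := hg
  have hεϑ : 0 ≤ ε * ϑ := by positivity
  by_cases h : m ≤ ϑ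
  · have h1 : ϑ ^ 2 ≤ pullBack ϑ ε m ∨ m + ε ≤ pullBack ϑ ε m := by
      rw [pullBack, if_pos h]
      rcases min_choice (ϑ ^ 2) (m + ε) with h | h <;> rw [h]
      · exact Or.inl (le_max_right _ _)
      · exact Or.inr (le_max_right _ _)
    rcases h1 with h1 | h1
    · have := mul_le_mul_of_nonneg_right h1 (by linarith : 0 ≤ g)
      nlinarith [sq_nonneg ϑ]
    · have := mul_le_mul_of_nonneg_right h1 (by linarith : 0 ≤ g)
      nlinarith
  · have h1 : ϑ - ε ≤ pullBack ϑ ε m := by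
      rw [pullBack, if_neg h]
      exact le_trans (le_min (by nlinarith) (by linarith)) (le_max_right _ _)
    have := mul_le_mul_of_nonneg_right h1 (by linarith : 0 ≤ g)
    nlinarith

/-! ### Frequency measurement and correction -/

namespace Run

variable {n : ℕ} (R : Run n)

/-- The middle of the time between the first pulses of rounds `r` and `r + 1`. -/
def midTime (v : Fin n) (r : ℕ) : ℝ := (R.p v r + R.p v (r + 1)) / 2

/-- The adjusted clock rate in the middle of a round. -/
def midRate (v : Fin n) (r : ℕ) : ℝ := R.μ v r * R.h v (R.midTime v r)

/-- The spread of the rates in the middle of a round. -/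
def midSpread (r : ℕ) : ℝ :=
  sSup ((fun v => R.midRate v r) '' (R.C : Set (Fin n)))
    - sInf ((fun v => R.midRate v r) '' (R.C : Set (Fin n)))

theorem le_midSpread (r : ℕ) {v w : Fin n} (hv : v ∈ R.C) (hw : w ∈ R.C) :
    R.midRate v r - R.midRate w r ≤ R.midSpread r := by
  have hf : ((fun v => R.midRate v r) '' (R.C : Set (Fin n))).Finite :=
    R.C.finite_toSet.image _
  exact sub_le_sSup_sub_sInf hf.bddBelow hf.bddAbove ⟨v, hv, rfl⟩ ⟨w, hw, rfl⟩

end Run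

/-- The part of the error of rate measurements that is not due to changing clock rates. -/
def rateErr (M : Model) (A : Tuning) : ℝ :=
  M.vbar * (1 - 1 / M.vbar) ^ 2 + M.vbar * M.U / (A.τ₂ + A.τ₃)

namespace Setup

variable {M : Model} {A : Tuning} {n : ℕ} {R : Run n}

theorem T_pos (hS : Setup M A R) : 0 < A.T := by
  linarith [(hS.constr.round_length hS.valid hS.small).1, e₁_pos hS.valid hS.small hS.constr,
    hS.valid.U_le, hS.valid.U_nonneg]

theorem νT_pos (hS : Setup M A R) : 0 < M.ν * A.T := mul_pos hS.valid.ν_pos hS.T_pos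

theorem sq_ϑ_le (hS : Setup M A R) : M.ϑ ^ 2 ≤ 1.0404 := by
  have := Model.ϑ_lt hS.valid hS.small
  have h1 := hS.valid.one_lt
  norm_num at this ⊢
  nlinarith

theorem dev_le (hS : Setup M A R) : M.dev ≤ 0.01 := by
  have := Model.ϑ_lt hS.valid hS.small
  have := (Model.dev_bounds hS.valid).2.1
  norm_num at *
  linarith

theorem rateErr_nonneg (hS : Setup M A R) : 0 ≤ rateErr M A := by
  have h1 := Model.one_lt_vbar hS.valid
  obtain ⟨-, -, -, -, -, c2, c3, -, -, d2, d3, -⟩ := hS.constr.waits hS.valid hS.small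
  exact add_nonneg (mul_nonneg (by linarith) (sq_nonneg _))
    (div_nonneg (mul_nonneg (by linarith) hS.valid.U_nonneg) (by linarith))

theorem le_ε (hS : Setup M A R) :
    2 * ((M.ϑ - 1) * (M.vbar - 1)) + 4 * rateErr M A + 8 * (M.ν * A.T) ≤ A.ε := by
  refine le_trans ?_ hS.constr.ε_ge
  have h1 := Model.one_lt_vbar hS.valid
  have h2 := hS.νT_pos
  have e1 : 2 * M.ϑ ^ 3 * M.U / (A.τ₂ + A.τ₃) = 2 * (M.vbar * M.U / (A.τ₂ + A.τ₃)) := by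
    unfold Model.vbar; ring
  rw [e1]
  change _ ≤ 2 * ((M.ϑ - 1) * (M.vbar - 1) + 2 * M.vbar * (1 - 1 / M.vbar) ^ 2
    + 2 * (M.vbar * M.U / (A.τ₂ + A.τ₃)) + 2 * (M.vbar + 1) * M.ν * A.T)
  unfold rateErr
  nlinarith

theorem ε_pos (hS : Setup M A R) : 0 < A.ε := by
  have h1 := hS.le_ε
  have h2 := hS.νT_pos
  have h3 := hS.rateErr_nonneg
  have h4 : 0 ≤ (M.ϑ - 1) * (M.vbar - 1) :=
    mul_nonneg (by linarith [hS.valid.one_lt]) (by linarith [Model.one_lt_vbar hS.valid])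
  linarith

/-- The bound by τ₂ is the source of T + τ₂ in the frequency error. -/
theorem phaseCorr_le (hS : Setup M A R) {r : ℕ} (hr : 1 ≤ r) {v : Fin n} (hv : v ∈ R.C) :
    R.phaseCorr M.ϑ v r ≤ 1.01 * (e₁ M A + M.U) ∧ R.phaseCorr M.ϑ v r ≤ A.τ₂ := by
  have h1 := (abs_le.1 (hS.abs_phaseCorr_le_e₁ hr (hS.regular r) hv)).2
  have h2 := hS.dev_le
  have he := e₁_pos hS.valid hS.small hS.constr
  have hU := hS.valid.U_nonneg
  have hd := hS.valid.U_le
  have hϑ := hS.valid.one_lt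
  have h4 : M.ϑ ≤ M.vbar := le_self_pow₀ hϑ.le (by norm_num)
  have h5 := (Model.dev_bounds hS.valid).2.1
  have h3 := hS.constr.τ₂_ge
  norm_num at *
  constructor
  · nlinarith
  · nlinarith

theorem round_length (hS : Setup M A R) {r : ℕ} (hr : 1 ≤ r) {v : Fin n} (hv : v ∈ R.C) :
    0 < R.p v (r + 1) - R.p v r ∧
    R.μ v r * (R.p v (r + 1) - R.p v r) ≤ A.T + A.τ₂ ∧
    R.p v (r + 1) - R.p v r ≤ A.T + 1.01 * (e₁ M A + M.U) := by
  obtain ⟨hlt, s, hs, hl⟩ := hS.exists_round_rate hr hv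
  obtain ⟨h1, h2⟩ := hS.phaseCorr_le hr hv
  have hp := ((hS.exec.nonneg v hv r).2 hr).1
  have hμ := hS.μ_mem hv r
  have hh := (hS.exec.clock v hv).rate s (hp.trans hs.1.le)
  have hpos := sub_pos.2 hlt
  have h3 : R.μ v r * (R.p v (r + 1) - R.p v r) ≤ A.T + R.phaseCorr M.ϑ v r := by
    rw [← hl, mul_right_comm]
    exact le_mul_of_one_le_right (mul_nonneg (by linarith [hμ.1]) hpos.le) hh.1
  have h4 : R.p v (r + 1) - R.p v r ≤ R.μ v r * (R.p v (r + 1) - R.p v r) :=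
    le_mul_of_one_le_left hpos.le hμ.1
  exact ⟨hpos, by linarith, by linarith⟩

theorem midRate_mem (hS : Setup M A R) {r : ℕ} (hr : 1 ≤ r) {v : Fin n} (hv : v ∈ R.C) :
    R.midRate v r ∈ Icc 1 M.vbar := by
  have hp := ((hS.exec.nonneg v hv r).2 hr).1
  have hp' := ((hS.exec.nonneg v hv (r + 1)).2 (by omega)).1
  exact hS.mul_clock_rate_mem hv r (by unfold Run.midTime; linarith)

/-- A rate differs from its value at the middle by at most ν times half the adjusted round length,
that is ν(T+τ₂)/2; two nodes contribute. -/
theorem rateSpread_le (hS : Setup M A R) {r : ℕ} (hr : 1 ≤ r) :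
    R.rateSpread r ≤ R.midSpread r + M.ν * (A.T + A.τ₂) := by
  have key : ∀ v ∈ R.C, ∀ s ∈ Icc (R.p v r) (R.p v (r + 1)),
      |R.μ v r * R.h v s - R.midRate v r| ≤ M.ν * (A.T + A.τ₂) / 2 := by
    intro v hv s hs
    obtain ⟨hpos, hlen, -⟩ := hS.round_length hr hv
    have hp := ((hS.exec.nonneg v hv r).2 hr).1
    have hμ := hS.μ_mem hv r
    have hlip := (hS.exec.clock v hv).lipschitz (R.midTime v r) s
      (by unfold Run.midTime; linarith) (hp.trans hs.1)
    have hdist : |s - R.midTime v r| ≤ (R.p v (r + 1) - R.p v r) / 2 := by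
      unfold Run.midTime; rw [abs_le]; constructor <;> linarith [hs.1, hs.2]
    have hν := hS.valid.ν_pos
    unfold Run.midRate
    rw [← mul_sub, abs_mul, abs_of_nonneg (by linarith [hμ.1])]
    calc R.μ v r * |R.h v s - R.h v (R.midTime v r)|
        ≤ R.μ v r * (M.ν * ((R.p v (r + 1) - R.p v r) / 2)) := by
          gcongr
          · linarith [hμ.1]
          · exact hlip.trans (by gcongr)
      _ = M.ν * (R.μ v r * (R.p v (r + 1) - R.p v r)) / 2 := by ring
      _ ≤ _ := by gcongr
  have hne : (R.rates r).Nonempty := by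
    obtain ⟨v, hv⟩ := hS.nonempty
    exact ⟨_, v, hv, R.p v r, ⟨le_rfl, by linarith [(hS.round_length hr hv).1]⟩, rfl⟩
  refine sSup_sub_sInf_le hne ?_
  rintro _ ⟨v, hv, s, hs, rfl⟩ _ ⟨w, hw, s', hs', rfl⟩
  have h1 := (abs_le.1 (key v hv s hs)).2
  have h2 := (abs_le.1 (key w hw s' hs')).1
  linarith [R.le_midSpread r hv hw]

theorem abs_rate_sub_midRate_le (hS : Setup M A R) {r : ℕ} (hr : 1 ≤ r) {v : Fin n}
    (hv : v ∈ R.C) {s : ℝ} (h0 : 0 ≤ s) (hs : R.p v r - e₁ M A ≤ s) (hs' : s ≤ R.p v (r + 1)) :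
    |R.μ v r * R.h v s - R.midRate v r| ≤ 0.9 * (M.ν * A.T) := by
  obtain ⟨hpos, -, hlen⟩ := hS.round_length hr hv
  have hp := ((hS.exec.nonneg v hv r).2 hr).1
  have hμ := hS.μ_mem hv r
  have hμ2 := hμ.2.trans hS.sq_ϑ_le
  have hlip := (hS.exec.clock v hv).lipschitz (R.midTime v r) s
    (by unfold Run.midTime; linarith) h0
  have hT := (hS.constr.round_length hS.valid hS.small).1
  have he := e₁_pos hS.valid hS.small hS.constr
  -- The distance is at most half a round plus e(1): pulses of faster nodes may arrive before `R.p v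
  -- r`. The constant uses 5e(1) + 2d + U ≤ T.
  have hdist : |s - R.midTime v r| ≤ 0.85 * A.T := by
    have hU := hS.valid.U_nonneg
    have hd := hS.valid.U_le
    unfold Run.midTime; rw [abs_le]
    norm_num at *
    constructor <;> linarith
  have hν := hS.valid.ν_pos
  have hT0 := hS.T_pos
  unfold Run.midRate
  rw [← mul_sub, abs_mul, abs_of_nonneg (by linarith [hμ.1])]
  calc R.μ v r * |R.h v s - R.h v (R.midTime v r)|
      ≤ 1.0404 * (M.ν * (0.85 * A.T)) := by
        gcongr
        exact hlip.trans (by gcongr)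
    _ ≤ 0.9 * (M.ν * A.T) := by nlinarith [hS.νT_pos]

/-- The rate of a clock changes little from one round to the next. -/
theorem abs_rate_drift_le (hS : Setup M A R) {r : ℕ} (hr : 1 ≤ r) {v : Fin n}
    (hv : v ∈ R.C) :
    |R.μ v r * R.h v (R.midTime v (r + 1)) - R.midRate v r| ≤ 1.4 * (M.ν * A.T) := by
  obtain ⟨hpos, -, hlen⟩ := hS.round_length hr hv
  obtain ⟨hpos', -, hlen'⟩ := hS.round_length (r := r + 1) (by omega) hv
  have hp := ((hS.exec.nonneg v hv r).2 hr).1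
  have hμ := hS.μ_mem hv r
  have hμ2 := hμ.2.trans hS.sq_ϑ_le
  have hlip := (hS.exec.clock v hv).lipschitz (R.midTime v r) (R.midTime v (r + 1))
    (by unfold Run.midTime; linarith) (by unfold Run.midTime; linarith)
  have hT := (hS.constr.round_length hS.valid hS.small).1
  have he := e₁_pos hS.valid hS.small hS.constr
  have hdist : |R.midTime v (r + 1) - R.midTime v r| ≤ 1.34 * A.T := by
    have hU := hS.valid.U_nonneg
    have hd := hS.valid.U_le
    unfold Run.midTime; rw [abs_le]
    norm_num at *
    constructor <;> linarith
  have hν := hS.valid.ν_pos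
  have hT0 := hS.T_pos
  unfold Run.midRate
  rw [← mul_sub, abs_mul, abs_of_nonneg (by linarith [hμ.1])]
  calc R.μ v r * |R.h v (R.midTime v (r + 1)) - R.h v (R.midTime v r)|
      ≤ 1.0404 * (M.ν * (1.34 * A.T)) := by
        gcongr
        exact hlip.trans (by gcongr)
    _ ≤ 1.4 * (M.ν * A.T) := by nlinarith [hS.νT_pos]

/-- Comparison of two rates `a` and `b` by counting over a time span known up to `u`. -/
theorem abs_ratio_sub_le {a b u L V W : ℝ} (ha : a ∈ Icc 1 V) (hb : b ∈ Icc 1 V)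
    (hu : |u| ≤ W) (hL : 0 < L) :
    |(1 - a * (L / b + u) / L) - (b - a)| ≤ V * (1 - 1 / V) ^ 2 + V * W / L := by
  obtain ⟨ha1, ha2⟩ := ha
  obtain ⟨hb1, hb2⟩ := hb
  have hb0 : 0 < b := by linarith
  -- Since 1 - a/b = (b-a)/b, replacing it by b-a costs (b-a)(1-1/b), which is of second order in
  -- V-1.
  have e : (1 - a * (L / b + u) / L) - (b - a) = -((b - a) * (1 - 1 / b)) - a * u / L := by
    field_simp; ring
  have h1 : 1 / V ≤ 1 / b := one_div_le_one_div_of_le hb0 hb2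
  have h2 : 1 / b ≤ 1 := by rw [div_le_one hb0]; exact hb1
  have h3 : |b - a| ≤ V - 1 := by rw [abs_le]; constructor <;> linarith
  have h4 : |(b - a) * (1 - 1 / b)| ≤ (V - 1) * (1 - 1 / V) := by
    rw [abs_mul, abs_of_nonneg (by linarith : 0 ≤ 1 - 1 / b)]
    exact mul_le_mul h3 (by linarith) (by linarith) (by linarith)
  have h5 : (V - 1) * (1 - 1 / V) = V * (1 - 1 / V) ^ 2 := by
    have : V ≠ 0 := by linarith
    field_simp
  have h6 : |a * u / L| ≤ V * W / L := by
    rw [abs_div, abs_of_pos hL, abs_mul, abs_of_nonneg (by linarith : 0 ≤ a)]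
    gcongr
    linarith
  rw [e]
  calc |(-((b - a) * (1 - 1 / b)) - a * u / L)|
      ≤ |(-((b - a) * (1 - 1 / b)))| + |a * u / L| := abs_sub _ _
    _ ≤ _ := by rw [abs_neg, ← h5]; exact add_le_add h4 h6

/-- By the mean value theorem, both the spacing of the pulses of `w` and the count of `v` are
governed by rates at single times, each within 0.9νT of its mid-round rate. Arrivals change the
spacing by at most U. -/
theorem exists_rateValue (hS : Setup M A R) {r : ℕ} (hr : 1 ≤ r) {v w : Fin n}
    (hv : v ∈ R.C) (hw : w ∈ R.C) :
    ∃ x : ℝ, rateValue (R.μ v r) (A.τ₂ + A.τ₃) (R.H v) (R.second w v r) (R.first w v r)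
        = (x : EReal) ∧
      |x - (R.midRate w r - R.midRate v r)| ≤ rateErr M A + 1.8 * (M.ν * A.T) := by
  obtain ⟨x, hx, y, hy, hxe, hye, htx, hxa, hay, hyb⟩ :=
    hS.exists_arrivals hr (hS.regular r) hv hw
  refine ⟨_, by rw [hxe, hye]; rfl, ?_⟩
  obtain ⟨a1, a2, a3, a4, c1, c2, c3, c4, d1, d2, d3, d4⟩ := hS.constr.waits hS.valid hS.small
  have hU := hS.valid.U_nonneg
  have hd := hS.valid.U_le
  have he := e₁_pos hS.valid hS.small hS.constr
  obtain ⟨-, -, ⟨w1, w2⟩, ⟨w3, -⟩, -⟩ := hS.round_times hw hr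
  have hwb := hS.b_le_p hw hr (Nat.lt_succ_self r)
  have hvb := hS.b_le_p hv hr (Nat.lt_succ_self r)
  have hwq := (hS.windows hr ((hS.regular r).close r hr le_rfl) hw hw).2.2.2
  have hcl := (hS.regular r).close r hr le_rfl v hv w hw
  have hp := ((hS.exec.nonneg w hw r).2 hr).1
  have ht := (hS.exec.nonneg v hv (r - 1)).1
  have hcv := hS.exec.clock v hv
  have hcw := hS.exec.clock w hw
  have hpq : R.p w r < R.q w r := by linarith
  obtain ⟨s, hs, hsl⟩ := hcw.exists_slope hp hpq
  obtain ⟨z, hz, hzl⟩ := hcv.exists_slope (ht.trans htx) (hxa.trans_lt hay)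
  have hB := hS.mul_clock_rate_mem hw r (hp.trans hs.1.le)
  have hA := hS.mul_clock_rate_mem hv r ((ht.trans htx).trans hz.1.le)
  have eB := hS.abs_rate_sub_midRate_le hr hw (hp.trans hs.1.le)
    (by linarith [hs.1]) (by linarith [hs.2])
  have eA := hS.abs_rate_sub_midRate_le hr hv ((ht.trans htx).trans hz.1.le)
    (by linarith [hz.1, hx.1]) (by linarith [hz.2])
  have hL : 0 < A.τ₂ + A.τ₃ := by linarith
  have hμw : 0 < R.μ w r := by linarith [(hS.μ_mem hw r).1]
  have hp1 := hS.exec.pulse₁ w hw r hr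
  have hq1 := hS.exec.pulse₂ w hw r hr
  rw [← hp1] at hq1
  have hBL : R.q w r - R.p w r = (A.τ₂ + A.τ₃) / (R.μ w r * R.h w s) := by
    rw [eq_div_iff (by linarith [hB.1])]
    have : R.μ w r * (R.H w (R.q w r) - R.H w (R.p w r)) = A.τ₂ + A.τ₃ := by
      rw [hq1]; field_simp; ring
    rw [← this, hsl]; ring
  have hu : |(y - x) - (R.q w r - R.p w r)| ≤ M.U := by
    rw [abs_le]; constructor <;> linarith [hx.1, hx.2, hy.1, hy.2]
  have main := abs_ratio_sub_le hA hB hu hL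
  rw [← hBL] at main
  have e : R.μ v r * (R.H v y - R.H v x)
      = R.μ v r * R.h v z * (R.q w r - R.p w r + (y - x - (R.q w r - R.p w r))) := by
    rw [hzl]; ring
  rw [e]
  unfold rateErr
  norm_num at *
  rw [abs_le] at main eA eB ⊢
  constructor <;> linarith [main.1, main.2, eA.1, eA.2, eB.1, eB.2]

/-- The bound on the deviation of a corrected rate from the agreement value. -/
def corrErr (M : Model) (A : Tuning) (S : ℝ) : ℝ :=
  rateErr M A + 3.2 * (M.ν * A.T) + M.dev * (S + (rateErr M A + 1.8 * (M.ν * A.T)))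

/-- Rates after the correction, before the pull-back. -/
theorem exists_corrected_bounds (hS : Setup M A R) {r : ℕ} (hr : 1 ≤ r) {lo hi : ℝ}
    (hlo : ∀ w ∈ R.C, lo ≤ R.midRate w r) (hhi : ∀ w ∈ R.C, R.midRate w r ≤ hi) :
    ∃ m ∈ Icc lo hi, ∀ v ∈ R.C, ∃ μ' g : ℝ, g ∈ Icc 1 M.ϑ ∧
      R.midRate v (r + 1) = pullBack M.ϑ A.ε μ' * g ∧
      (lo + m) / 2 - corrErr M A (hi - lo) ≤ μ' * g ∧
      μ' * g ≤ (m + hi) / 2 + corrErr M A (hi - lo) := by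
  obtain ⟨m, hm, h⟩ := exists_agree_bounds hS.exec.n_pos hS.exec.faults
    (fun w => R.midRate w r) hlo hhi
  refine ⟨m, hm, fun v hv => ?_⟩
  have hξ := h _ (R.midRate v r) (rateErr M A + 1.8 * (M.ν * A.T))
    fun w hw => hS.exists_rateValue hr hv hw
  change _ ≤ R.rateCorr (A.τ₂ + A.τ₃) v r ∧ R.rateCorr (A.τ₂ + A.τ₃) v r ≤ _ at hξ
  set ξ := R.rateCorr (A.τ₂ + A.τ₃) v r with hξdef
  have hp := ((hS.exec.nonneg v hv (r + 1)).2 (by omega)).1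
  have hp' := ((hS.exec.nonneg v hv (r + 1 + 1)).2 (by omega)).1
  have hg := (hS.exec.clock v hv).rate (R.midTime v (r + 1)) (by unfold Run.midTime; linarith)
  refine ⟨R.μ v r + 2 * ξ / (M.ϑ + 1), R.h v (R.midTime v (r + 1)), hg, ?_, ?_⟩
  · rw [hξdef, ← hS.exec.rate v hv r hr]; rfl
  · have hdrift := hS.abs_rate_drift_le hr hv
    set g := R.h v (R.midTime v (r + 1))
    have hϑ := hS.valid.one_lt
    -- The correction changes the rate by ξ·2g/(ϑ+1), which is ξ up to the relative error `M.dev`.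
    -- The drift of the clock until the next mid-round is treated separately.
    have e : (R.μ v r + 2 * ξ / (M.ϑ + 1)) * g
        = R.μ v r * g + ξ + ξ * (2 * g / (M.ϑ + 1) - 1) := by field_simp; ring
    have hdev : |2 * g / (M.ϑ + 1) - 1| ≤ M.dev := by
      have e2 : 2 * g / (M.ϑ + 1) - 1 = (2 * g - (M.ϑ + 1)) / (M.ϑ + 1) := by
        field_simp
      rw [e2, abs_div, abs_of_pos (by linarith : 0 < M.ϑ + 1), Model.dev]
      refine div_le_div_of_nonneg_right ?_ (by linarith)
      rw [abs_le]; constructor <;> linarith [hg.1, hg.2]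
    have hξabs : |ξ| ≤ (hi - lo) + (rateErr M A + 1.8 * (M.ν * A.T)) := by
      have := hlo v hv; have := hhi v hv
      rw [abs_le]; constructor <;> linarith [hm.1, hm.2]
    have hprod : |ξ * (2 * g / (M.ϑ + 1) - 1)|
        ≤ M.dev * ((hi - lo) + (rateErr M A + 1.8 * (M.ν * A.T))) := by
      rw [abs_mul, mul_comm]
      exact mul_le_mul hdev hξabs (abs_nonneg _) (Model.dev_bounds hS.valid).1
    rw [e]
    unfold corrErr
    rw [abs_le] at hdrift hprod
    norm_num at *
    constructor <;> linarith [hdrift.1, hdrift.2, hprod.1, hprod.2]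

/-- The first bound lets the pull-back absorb the error and so preserves the band. In the second,
(ϑ-1)S is what raises the contraction factor from 1/2 to β. -/
theorem corrErr_le (hS : Setup M A R) {S : ℝ} (hS0 : 0 ≤ S) (hS1 : S ≤ M.vbar - 1) :
    corrErr M A S ≤ A.ε ∧ 2 * corrErr M A S ≤ (M.ϑ - 1) * S + A.ε := by
  have h1 := hS.le_ε
  have h2 := hS.νT_pos
  have h3 := hS.rateErr_nonneg
  have h4 := hS.dev_le
  obtain ⟨h5, h6, -⟩ := Model.dev_bounds hS.valid
  have hϑ := hS.valid.one_lt
  have hv := Model.one_lt_vbar hS.valid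
  have h7 : M.dev * S ≤ (M.ϑ - 1) / 2 * S := mul_le_mul_of_nonneg_right h6 hS0
  have h8 : M.dev * (rateErr M A + 1.8 * (M.ν * A.T))
      ≤ 0.01 * (rateErr M A + 1.8 * (M.ν * A.T)) :=
    mul_le_mul_of_nonneg_right h4 (by norm_num; linarith)
  have h9 : (M.ϑ - 1) * S ≤ (M.ϑ - 1) * (M.vbar - 1) :=
    mul_le_mul_of_nonneg_left hS1 (by linarith)
  have h10 : 0 ≤ (M.ϑ - 1) * S := mul_nonneg (by linarith) hS0
  unfold corrErr
  norm_num at *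
  constructor <;> linarith

theorem exists_midRate_extremes (hS : Setup M A R) (r : ℕ) :
    ∃ x ∈ R.C, ∃ y ∈ R.C, (∀ w ∈ R.C, R.midRate x r ≤ R.midRate w r) ∧
      ∀ w ∈ R.C, R.midRate w r ≤ R.midRate y r := by
  obtain ⟨x, hx, h1⟩ := R.C.exists_min_image (fun w => R.midRate w r) hS.nonempty
  obtain ⟨y, hy, h2⟩ := R.C.exists_max_image (fun w => R.midRate w r) hS.nonempty
  exact ⟨x, hx, y, hy, h1, h2⟩

/-- Rates remain close to the range `[ϑ, ϑ²]` of the nominally adjusted clocks. -/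
theorem midRate_band (hS : Setup M A R) {r : ℕ} (hr : 1 ≤ r) :
    ∀ v ∈ R.C, M.ϑ - A.ε * M.ϑ ≤ R.midRate v r ∧ R.midRate v r ≤ M.ϑ ^ 2 + A.ε * M.ϑ := by
  have hϑ := hS.valid.one_lt
  have hε := hS.ε_pos
  induction r, hr using Nat.le_induction with
  | base =>
    intro v hv
    have hp := ((hS.exec.nonneg v hv 1).2 le_rfl).1
    have hp' := ((hS.exec.nonneg v hv (1 + 1)).2 (by omega)).1
    have hg := (hS.exec.clock v hv).rate (R.midTime v 1) (by unfold Run.midTime; linarith)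
    unfold Run.midRate
    rw [hS.exec.μ_one v hv]
    have : 0 ≤ A.ε * M.ϑ := by positivity
    constructor <;> nlinarith [hg.1, hg.2]
  | succ r hr ih =>
    intro v hv
    obtain ⟨x, hx, y, hy, hlo, hhi⟩ := hS.exists_midRate_extremes r
    obtain ⟨m, hm, h⟩ := hS.exists_corrected_bounds hr hlo hhi
    obtain ⟨μ', g, hg, he, h1, h2⟩ := h v hv
    have hc := (hS.corrErr_le (sub_nonneg.2 (hlo y hy))
      (by linarith [(hS.midRate_mem hr hx).1, (hS.midRate_mem hr hy).2])).1
    rw [he]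
    exact ⟨le_pullBack_mul hϑ hε.le hg hc (ih x hx).1 (by linarith [hm.1, hm.2]),
      pullBack_mul_le hϑ hε.le hg hc (ih y hy).2 (by linarith [hm.1, hm.2])⟩

theorem midSpread_succ_le (hS : Setup M A R) {r : ℕ} (hr : 1 ≤ r) :
    R.midSpread (r + 1) ≤ M.beta * R.midSpread r + 3 * M.ϑ * A.ε := by
  have hϑ := hS.valid.one_lt
  have hε := hS.ε_pos
  obtain ⟨x, hx, y, hy, hlo, hhi⟩ := hS.exists_midRate_extremes r
  obtain ⟨m, hm, h⟩ := hS.exists_corrected_bounds hr hlo hhi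
  have hS0 : 0 ≤ R.midRate y r - R.midRate x r := sub_nonneg.2 (hlo y hy)
  obtain ⟨hc, hc2⟩ := hS.corrErr_le hS0
    (by linarith [(hS.midRate_mem hr hx).1, (hS.midRate_mem hr hy).2])
  have hband := hS.midRate_band hr
  have hspread := R.le_midSpread r hy hx
  set S := R.midRate y r - R.midRate x r
  have hβ : M.beta * S ≤ M.beta * R.midSpread r :=
    mul_le_mul_of_nonneg_left hspread (by unfold Model.beta; linarith)
  have hβ0 : 0 ≤ M.beta * S := mul_nonneg (by unfold Model.beta; linarith) hS0
  have hβS : M.beta * S = S / 2 + (M.ϑ - 1) * S := by unfold Model.beta; ring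
  have hεϑ : A.ε ≤ M.ϑ * A.ε := le_mul_of_one_le_left hε.le hϑ.le
  refine sSup_sub_sInf_le ((Finset.coe_nonempty.2 hS.nonempty).image _) ?_
  rintro _ ⟨v, hv, rfl⟩ _ ⟨w, hw, rfl⟩
  obtain ⟨μv, gv, hgv, ev, v1, v2⟩ := h v hv
  obtain ⟨μw, gw, hgw, ew, w1, w2⟩ := h w hw
  simp only [ev, ew]
  have hbx := (hband x hx).1
  have hby := (hband y hy).2
  have upper : pullBack M.ϑ A.ε μv * gv ≤ μv * gv + M.ϑ * A.ε ∨
      pullBack M.ϑ A.ε μv * gv ≤ M.ϑ := by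
    rcases pullBack_cases_le (ϑ := M.ϑ) A.ε μv hε.le with h | h
    · left
      have := mul_le_mul_of_nonneg_right h (by linarith [hgv.1] : 0 ≤ gv)
      nlinarith [mul_le_mul_of_nonneg_left hgv.2 hε.le]
    · right; rw [h, one_mul]; exact hgv.2
  have lower : μw * gw - M.ϑ * A.ε ≤ pullBack M.ϑ A.ε μw * gw ∨
      M.ϑ ^ 2 ≤ pullBack M.ϑ A.ε μw * gw := by
    rcases pullBack_cases_ge (ϑ := M.ϑ) A.ε μw hε.le with h | h
    · left
      have := mul_le_mul_of_nonneg_right h (by linarith [hgw.1] : 0 ≤ gw)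
      nlinarith [mul_le_mul_of_nonneg_left hgw.2 hε.le]
    · right
      nlinarith [hgw.1, sq_nonneg M.ϑ]
  have hϑ2 : M.ϑ ≤ M.ϑ ^ 2 := by nlinarith
  have hm1 := hm.1
  have hm2 := hm.2
  have hSdef : S = R.midRate y r - R.midRate x r := rfl
  -- Without restriction the agreement bounds give βS + 3ϑε. If one rate is restricted, the band
  -- bounds the difference by 3ϑε alone; if both are, it is at most ϑ - ϑ² < 0.
  rcases upper with hu | hu <;> rcases lower with hl | hl <;> linarith

end Setup

/-! ### Parameters for long rounds -/

/-- The bound on the steady state frequency error. -/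
def freqBound (M : Model) (A : Tuning) : ℝ :=
  (3 * M.ϑ * A.ε + 2 * M.ν * (A.T + A.τ₂)) / (1 - M.beta) + M.ν * (A.T + A.τ₂)

/-- The bound on the steady state error. -/
def phaseBound (M : Model) (A : Tuning) : ℝ :=
  ((4 * M.vbar - 2) * M.U + M.ν * (A.T + A.τ₂) * A.T) / (1 - M.alpha)
    + (3 * M.ϑ * A.ε + 2 * M.ν * (A.T + A.τ₂)) * A.T / ((1 - M.alpha) * (1 - M.beta))

/-- A choice of parameters for long rounds: a constant fraction of the round is spent on measuring
rates. -/
def longRounds (M : Model) (T : ℝ) : Tuning where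
  τ₁ := T / 10
  τ₂ := T / 10
  τ₃ := T / 10
  τ₄ := T / 10
  T := T
  ε := 2 * ((M.ϑ - 1) * (M.ϑ ^ 3 - 1) + 2 * M.ϑ ^ 3 * (1 - 1 / M.ϑ ^ 3) ^ 2
      + 2 * M.ϑ ^ 3 * M.U / (T / 10 + T / 10) + 2 * (M.ϑ ^ 3 + 1) * M.ν * T)

/-- As T ≥ 10⁶U, the hypothesis (ϑ̄-1)²T ≤ U forces the drift below the square root of 10⁻⁶. -/
theorem longRounds_small {M : Model} (hM : M.Valid) {T : ℝ}
    (hT : 10 ^ 6 * (M.F + M.d + M.U) ≤ T) (hU : (M.vbar - 1) ^ 2 * T ≤ M.U) :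
    0 < T ∧ M.vbar - 1 ≤ 1 / 1000 := by
  have h1 := hM.F_pos
  have h2 := hM.U_nonneg
  have h3 := hM.U_le
  have hT0 : 0 < T := by linarith
  have hv := Model.one_lt_vbar hM
  refine ⟨hT0, ?_⟩
  by_contra! h
  have h4 : (1 / 1000 : ℝ) ^ 2 < (M.vbar - 1) ^ 2 := pow_lt_pow_left₀ h (by norm_num) (by norm_num)
  have h5 := mul_lt_mul_of_pos_right h4 hT0
  norm_num at h5
  linarith

theorem e₁_longRounds_le {M : Model} (hM : M.Valid) (hα : M.alphaBar < 1) {T : ℝ}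
    (hT : 10 ^ 6 * (M.F + M.d + M.U) ≤ T) (hU : (M.vbar - 1) ^ 2 * T ≤ M.U) :
    e₁ M (longRounds M T) ≤ T / 100 := by
  obtain ⟨hT0, hx⟩ := longRounds_small hM hT hU
  have h1 := hM.F_pos
  have h2 := hM.U_nonneg
  have h3 := hM.U_le
  have hv := Model.one_lt_vbar hM
  have hβ := Model.betaBar_lt hM hα
  have hinv : 1 - 1 / M.vbar ≤ 1 / 1000 := by
    have : 1 - 1 / M.vbar = (M.vbar - 1) / M.vbar := by
      have : M.vbar ≠ 0 := by linarith
      field_simp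
    rw [this, div_le_iff₀ (by linarith)]
    linarith
  have hinvT := mul_le_mul_of_nonneg_right hinv hT0.le
  refine max_le ?_ ?_
  · change M.F + (1 - 1 / M.vbar) * (T / 10) ≤ _
    linarith
  · change ((1 - 1 / M.vbar) * T + _) / _ ≤ _
    norm_num at hβ
    have hUv : M.vbar * M.U ≤ 1.001 * M.U :=
      mul_le_mul_of_nonneg_right (by norm_num; linarith) h2
    norm_num at hUv
    have hβT : 38 / 100 * T ≤ (1 - M.betaBar) * T :=
      mul_le_mul_of_nonneg_right (by linarith) hT0.le
    rw [div_le_iff₀ (by linarith)]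
    linarith

theorem constraints_longRounds {M : Model} (hM : M.Valid) (hα : M.alphaBar < 1) {T : ℝ}
    (hT : 10 ^ 6 * (M.F + M.d + M.U) ≤ T) (hU : (M.vbar - 1) ^ 2 * T ≤ M.U) :
    Constraints M (longRounds M T) := by
  obtain ⟨hT0, hx⟩ := longRounds_small hM hT hU
  have he := e₁_longRounds_le hM hα hT hU
  have h1 := hM.F_pos
  have h2 := hM.U_nonneg
  have h3 := hM.U_le
  have hv := Model.one_lt_vbar hM
  -- Every lower bound on a waiting time has the form ϑ̄z with z ≤ T/50, well below the available
  -- T/10.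
  have hvb : ∀ z, z ≤ T / 50 → M.vbar * z ≤ T / 40 := by
    intro z hz
    have := mul_le_mul_of_nonneg_left hz (by linarith : 0 ≤ M.vbar)
    have := mul_le_mul_of_nonneg_right hx hT0.le
    linarith
  have hinv : (1 - 1 / M.vbar) * (T / 10 + T / 10) ≤ T / 1000 := by
    have h4 : 1 - 1 / M.vbar ≤ 1 / 1000 := by
      have : 1 - 1 / M.vbar = (M.vbar - 1) / M.vbar := by
        have : M.vbar ≠ 0 := by linarith
        field_simp
      rw [this, div_le_iff₀ (by linarith)]
      linarith
    have := mul_le_mul_of_nonneg_right h4 hT0.le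
    linarith
  refine ⟨?_, ?_, ?_, ?_, ?_, le_rfl⟩
  · change _ ≤ T / 10
    linarith [hvb _ (he.trans (by linarith))]
  · change _ ≤ T / 10
    linarith [hvb (e₁ M (longRounds M T) + M.d) (by linarith)]
  · change M.vbar * (_ + (1 - 1 / M.vbar) * (T / 10 + T / 10)) ≤ T / 10
    linarith [hvb (e₁ M (longRounds M T) + (1 - 1 / M.vbar) * (T / 10 + T / 10)) (by linarith)]
  · change M.vbar * (_ + (1 - 1 / M.vbar) * (T / 10 + T / 10)) ≤ T / 10
    linarith [hvb (e₁ M (longRounds M T) + M.d + (1 - 1 / M.vbar) * (T / 10 + T / 10))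
      (by linarith)]
  · change T / 10 + T / 10 + T / 10 + T / 10 + _ ≤ T
    linarith [hvb (e₁ M (longRounds M T) + M.U) (by linarith)]

/-! ### Steady-state bounds -/

namespace Setup

variable {M : Model} {A : Tuning} {n : ℕ} {R : Run n}

theorem eventually_rateSpread_le (hS : Setup M A R) :
    ∀ η > 0, ∀ᶠ r in atTop, R.rateSpread r ≤ freqBound M A + η := by
  intro η hη
  have hϑ := Model.ϑ_lt hS.valid hS.small
  have hϑ1 := hS.valid.one_lt
  norm_num at hϑ
  have hτ : 0 ≤ 2 * M.ν * (A.T + A.τ₂) := by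
    obtain ⟨-, -, -, -, -, c2, -, -, -, d2, -⟩ := hS.constr.waits hS.valid hS.small
    have := hS.T_pos
    exact mul_nonneg (by linarith [hS.valid.ν_pos]) (by linarith)
  -- Y exceeds the actual perturbation by 2ν(T+τ₂) ≥ 0, which is slack in the stated bound.
  have h := eventually_le_of_contraction (x := R.midSpread) (y := fun _ => 3 * M.ϑ * A.ε)
    (a := M.beta) (Y := 3 * M.ϑ * A.ε + 2 * M.ν * (A.T + A.τ₂)) (N := 1)
    (by unfold Model.beta; linarith) (by unfold Model.beta; linarith)
    (fun r hr => hS.midSpread_succ_le hr)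
    (fun η hη => Eventually.of_forall fun _ => by linarith) η hη
  filter_upwards [h, eventually_ge_atTop 1] with r h1 hr
  unfold freqBound
  linarith [hS.rateSpread_le hr]

theorem steadyStateRate_le (hS : Setup M A R) :
    R.steadyStateRate ≤ ((freqBound M A : ℝ) : EReal) :=
  limsup_coe_le hS.eventually_rateSpread_le

theorem phaseBound_eq (hS : Setup M A R) :
    phaseBound M A = ((4 * M.vbar - 2) * M.U + A.T * freqBound M A) / (1 - M.alpha) := by
  have hα := Model.alpha_lt hS.valid hS.small
  have hϑ := Model.ϑ_lt hS.valid hS.small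
  norm_num at hα hϑ
  have h1 : 1 - M.alpha ≠ 0 := by linarith
  have h2 : 1 - M.beta ≠ 0 := by unfold Model.beta; linarith
  unfold phaseBound freqBound
  field_simp
  ring

theorem steadyState_le (hS : Setup M A R) :
    R.steadyState ≤ ((phaseBound M A : ℝ) : EReal) := by
  have hα := Model.alpha_lt hS.valid hS.small
  norm_num at hα
  have hT := hS.T_pos
  refine limsup_coe_le ?_
  rw [hS.phaseBound_eq]
  refine eventually_le_of_contraction (N := 1) (Model.alpha_nonneg hS.valid) (by linarith)
    (fun r hr => hS.skew_succ_le hr) fun η hη => ?_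
  filter_upwards [hS.eventually_rateSpread_le (η / A.T) (by positivity)] with r hr
  have h1 := mul_le_mul_of_nonneg_left hr hT.le
  have h2 : A.T * (freqBound M A + η / A.T) = A.T * freqBound M A + η := by field_simp
  linarith

theorem freqBound_le (hS : Setup M A R) : freqBound M A ≤ 10 * A.ε := by
  have hϑ := Model.ϑ_lt hS.valid hS.small
  have h1 := hS.le_ε
  have h2 := hS.νT_pos
  have h3 := hS.rateErr_nonneg
  have h4 : 0 ≤ (M.ϑ - 1) * (M.vbar - 1) :=
    mul_nonneg (by linarith [hS.valid.one_lt]) (by linarith [Model.one_lt_vbar hS.valid])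
  have h5 : M.ν * (A.T + A.τ₂) ≤ 2 * (M.ν * A.T) := by
    have := mul_le_mul_of_nonneg_left (hS.constr.round_length hS.valid hS.small).2.1
      hS.valid.ν_pos.le
    linarith
  have h6 : 3 * M.ϑ * A.ε ≤ 3.06 * A.ε :=
    mul_le_mul_of_nonneg_right (by norm_num at *; linarith) hS.ε_pos.le
  -- From 8νT ≤ ε and τ₂ ≤ T the numerator is at most 3.56ε, and 1-β = 3/2 - ϑ ≥ 0.48.
  have h7 : (3 * M.ϑ * A.ε + 2 * M.ν * (A.T + A.τ₂)) / (1 - M.beta) ≤ 9 * A.ε := by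
    have hβ : 0.48 ≤ 1 - M.beta := by unfold Model.beta; norm_num at *; linarith
    rw [div_le_iff₀ (by norm_num at *; linarith)]
    have := mul_le_mul_of_nonneg_left hβ (by linarith [hS.ε_pos] : 0 ≤ 9 * A.ε)
    norm_num at *
    linarith
  unfold freqBound
  linarith

/-- The drift terms of ε are quadratic, so T times them is controlled by (ϑ̄-1)²T ≤ U. The delay
term is O(U) as τ₂+τ₃ = T/5, and the last one is O(νT²). -/
theorem phaseBound_longRounds_le {T : ℝ} (hS : Setup M (longRounds M T) R)
    (hT : 10 ^ 6 * (M.F + M.d + M.U) ≤ T) (hU : (M.vbar - 1) ^ 2 * T ≤ M.U)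
    (hν : M.ν * T ^ 2 ≤ M.U) : phaseBound M (longRounds M T) ≤ 10000 * M.U := by
  obtain ⟨hT0, hx⟩ := longRounds_small hS.valid hT hU
  have hv := Model.one_lt_vbar hS.valid
  have hα := Model.alpha_lt hS.valid hS.small
  have hϑ := hS.valid.one_lt
  have h2 := hS.valid.U_nonneg
  have hϑv : M.ϑ ≤ M.vbar := le_self_pow₀ hϑ.le (by norm_num)
  have hf : T * freqBound M (longRounds M T) ≤ T * (10 * (longRounds M T).ε) :=
    mul_le_mul_of_nonneg_left hS.freqBound_le hT0.le
  have hε : T * (longRounds M T).ε = 2 * ((M.ϑ - 1) * (M.vbar - 1) * T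
      + 2 * M.vbar * (1 - 1 / M.vbar) ^ 2 * T + 10 * M.vbar * M.U
      + 2 * (M.vbar + 1) * (M.ν * T ^ 2)) := by
    simp only [longRounds, Model.vbar]
    field_simp
    ring
  have g1 : (M.ϑ - 1) * (M.vbar - 1) * T ≤ M.U := by
    refine le_trans ?_ hU
    rw [sq]
    gcongr
  have g2 : M.vbar * (1 - 1 / M.vbar) ^ 2 * T ≤ M.U := by
    have : M.vbar * (1 - 1 / M.vbar) ^ 2 * T = (M.vbar - 1) ^ 2 * T / M.vbar := by
      have : M.vbar ≠ 0 := by linarith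
      field_simp
    rw [this]
    exact (div_le_self (by positivity) hv.le).trans hU
  have g3 : M.vbar * M.U ≤ 2 * M.U := mul_le_mul_of_nonneg_right (by linarith) h2
  have g4 : (M.vbar + 1) * (M.ν * T ^ 2) ≤ 3 * M.U :=
    mul_le_mul (by linarith) hν (mul_nonneg hS.valid.ν_pos.le (by positivity)) (by norm_num)
  norm_num at hα
  rw [hS.phaseBound_eq, div_le_iff₀ (by linarith)]
  change (4 * M.vbar - 2) * M.U + T * freqBound M (longRounds M T) ≤ _
  have h8 : 3 / 10 * (10000 * M.U) ≤ (1 - M.alpha) * (10000 * M.U) :=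
    mul_le_mul_of_nonneg_right (by linarith) (by linarith)
  linarith

end Setup

end ClockSync

end

theorem theorem3 :
    (∀ M : Model, M.Valid → M.ϑ ≤ 1.01 → M.alphaBar < 1) ∧
    ∃ c₁ c₂ K : ℝ, ∀ M : Model, M.Valid → M.alphaBar < 1 →
      (M.alpha < 1 ∧ M.beta < 1) ∧
      (∀ A : Tuning, Constraints M A → ∀ (n : ℕ) (R : Run n), IsExecution M A R →
        R.steadyStateRate ≤
          (((3 * M.ϑ * A.ε + 2 * M.ν * (A.T + A.τ₂)) / (1 - M.beta)
            + M.ν * (A.T + A.τ₂) : ℝ) : EReal) ∧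
        R.steadyStateRate ≤ ((c₁ * A.ε : ℝ) : EReal) ∧
        R.steadyState ≤
          ((((4 * M.vbar - 2) * M.U + M.ν * (A.T + A.τ₂) * A.T) / (1 - M.alpha)
            + (3 * M.ϑ * A.ε + 2 * M.ν * (A.T + A.τ₂)) * A.T
              / ((1 - M.alpha) * (1 - M.beta)) : ℝ) : EReal)) ∧
      (∀ T : ℝ, K * (M.F + M.d + M.U) ≤ T →
        max ((M.vbar - 1) ^ 2 * T) (M.ν * T ^ 2) ≤ M.U →
        ∃ A : Tuning, A.T = T ∧ Constraints M A ∧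
          ∀ (n : ℕ) (R : Run n), IsExecution M A R →
            R.steadyState ≤ ((c₂ * M.U : ℝ) : EReal)) := by
  refine ⟨fun M hM h => Model.alphaBar_lt_one hM h, 10, 10000, 10 ^ 6, fun M hM hα => ?_⟩
  have hϑ := Model.ϑ_lt hM hα
  have hα' := Model.alpha_lt hM hα
  refine ⟨⟨by norm_num at hα'; linarith, by unfold Model.beta; norm_num at hϑ; linarith⟩,
    fun A hA n R hR => ?_, fun T hT hU => ?_⟩
  · have hS : Setup M A R := ⟨hM, hα, hA, hR⟩
    refine ⟨hS.steadyStateRate_le, hS.steadyStateRate_le.trans ?_, hS.steadyState_le⟩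
    exact EReal.coe_le_coe_iff.2 hS.freqBound_le
  · have hmax := max_le_iff.1 hU
    have hA := constraints_longRounds hM hα hT hmax.1
    refine ⟨longRounds M T, rfl, hA, fun n R hR => ?_⟩
    have hS : Setup M (longRounds M T) R := ⟨hM, hα, hA, hR⟩
    exact hS.steadyState_le.trans
      (EReal.coe_le_coe_iff.2 (hS.phaseBound_longRounds_le hT hmax.1 hmax.2))
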